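/- A NAND-AND-OR-NOT DAG is a finite directed acyclic graph $G=(V,E)$ with $V=\{v_1,\dots,v_n\}$, without vertices of out-degree $1$, with a root $v_s$, in which every sink is labeled with a Boolean variable, every other vertex $v_i$ is labeled with a function $h_i\in\{\mathrm{NAND},\mathrm{AND},\mathrm{OR}\}$, and every edge $(v_i,v_j)$ carries a label $\sigma(i,j)\in\{0,1\}$. It is a NAND-NOT DAG if all $h_i$ are $\mathrm{NAND}$. Given values of the variables, the value $r_i$ of a sink is the value of its variable, and $r_i=h_i\big(r_{j_1}^{\sigma(i,j_1)},\dots,r_{j_w}^{\sigma(i,j_w)}\big)$ for any other vertex $v_i$ with list of out-neighbors $D_i=(v_{j_1},\dots,v_{j_w})$, where $x^1=x$ and $x^0=\neg x$. The DAG evaluates to $r_s$. Put $m=|E|$, $d_i=|D_i|$, and let $\hat n$ be the number of vertices with at least one outgoing edge; assume $\hat n\ge 2$. The graph is given by its lists $D_i$, of known lengths $d_i$; the entries of the lists, the gates, the edge labels and the variables are accessed by quantum queries. Running time means the number of queries in the worst case; algorithms are classical programs with quantum query algorithms as subroutines. Consider the following algorithm. 1. If the graph is not ordered (topologically sorted with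 the sinks at the end), sort it topologically by depth-first searches from a given list of vertices from some member of which $v_s$ is reachable (such as the list of all sources). The searches visit non-sinks only. The next vertex to visit in a list $D_i$ is found by a quantum subroutine $\mathrm{FirstOneSearch}(D_i,\mathit{start})$ for the first position $z>\mathit{start}$ that holds a non-visited non-sink. 2. For the non-sinks $v_i$ from the last one in the order down to $v_s$, compute $t[i]$ from the values already computed: repeat $\lceil 2\log_2\hat n\rceil$ times a quantum search among the $d_i$ arguments $t_f(j_1)^{\sigma(i,j_1)},\dots,t_f(j_{d_i})^{\sigma(i,j_{d_i})}$ of $h_i$ for a $0$ (if $h_i$ is $\mathrm{AND}$ or $\mathrm{NAND}$) or for a $1$ (if $h_i$ is $\mathrm{OR}$), and determine $h_i$ according to whether some repetition found such an argument. Here $t_f(j)$ is the variable at $v_j$ if $v_j$ is a sink, and $t[j]$ otherwise. 3. Return $t_f(s)$. Theorem. There are quantum subroutines $\mathrm{FirstOneSearch}$, with error probability at most $1/\hat n^2$ and running time $O(\sqrt{z-\mathit{start}}\,\log\hat n)$ (with $z=d_i$ if nothing is found), and search among $d$ arguments, with one-sided error probability at most $1/2$ and running time $O(\sqrt d)$,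 such that the algorithm with these subroutines evaluates every NAND-NOT DAG and every NAND-AND-OR-NOT DAG, for all values of the variables, with running time $O(\sqrt{\hat n m}\,\log\hat n)=O(\sqrt{nm}\,\log n)$ and error probability $O(1/\hat n)$. The constants in the $O$ are absolute. -/

import Mathlib

/-! # Quantum query programs

The input is a string `x : I → A` that can only be accessed through the unitary
`|i⟩|z⟩|w⟩ ↦ |i⟩|z + x i⟩|w⟩`. -/

namespace QQuery

/-- Computational basis: query register, answer register, `w`-dimensional work space. -/
abbrev Basis (I A : Type) (w : ℕ) : Type := I × A × Fin w

section Circuits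

variable {I A : Type} [Fintype I] [DecidableEq I] [Fintype A] [DecidableEq A] [AddCommGroup A]

set_option linter.unusedSectionVars false

/-- The query unitary `|i⟩|z⟩|w⟩ ↦ |i⟩|z + x i⟩|w⟩`, acting on amplitude vectors. -/
def applyQuery (x : I → A) {w : ℕ} (ψ : Basis I A w → ℂ) : Basis I A w → ℂ :=
  fun b => ψ (b.1, b.2.1 - x b.1, b.2.2)

/-- The state `U_T O_x U_{T-1} O_x ⋯ O_x U_0 |init⟩`, where `O_x` is the query unitary. -/
noncomputable def finalState (x : I → A) {w : ℕ} (init : Basis I A w)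
    (U : ℕ → Matrix.unitaryGroup (Basis I A w) ℂ) : ℕ → Basis I A w → ℂ
  | 0 => (U 0).1.mulVec (Pi.single init 1)
  | T + 1 => (U (T + 1)).1.mulVec (applyQuery x (finalState x init U T))

theorem sum_sq_mulVec {B : Type} [Fintype B] [DecidableEq B] (U : Matrix.unitaryGroup B ℂ)
    (ψ : B → ℂ) : ∑ b, ‖U.1.mulVec ψ b‖ ^ 2 = ∑ b, ‖ψ b‖ ^ 2 := by
  have key : ∀ φ : B → ℂ, ((∑ b, ‖φ b‖ ^ 2 : ℝ) : ℂ) = star φ ⬝ᵥ φ := by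
    intro φ
    push_cast
    refine Finset.sum_congr rfl fun b _ => ?_
    simp [← Complex.conj_mul']
  have h : star (U.1.mulVec ψ) ⬝ᵥ U.1.mulVec ψ = star ψ ⬝ᵥ ψ := by
    rw [Matrix.star_mulVec, Matrix.dotProduct_mulVec, Matrix.vecMul_vecMul,
      ← Matrix.star_eq_conjTranspose, Matrix.UnitaryGroup.star_mul_self, Matrix.vecMul_one]
  exact_mod_cast (key _).trans (h.trans (key _).symm)

theorem sum_sq_applyQuery (x : I → A) {w : ℕ} (ψ : Basis I A w → ℂ) :
    ∑ b, ‖applyQuery x ψ b‖ ^ 2 = ∑ b, ‖ψ b‖ ^ 2 := by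
  let e : Basis I A w ≃ Basis I A w :=
    { toFun := fun b => (b.1, b.2.1 - x b.1, b.2.2)
      invFun := fun b => (b.1, b.2.1 + x b.1, b.2.2)
      left_inv := fun b => by simp
      right_inv := fun b => by simp }
  exact Equiv.sum_comp e (fun b => ‖ψ b‖ ^ 2)

theorem sum_sq_finalState (x : I → A) {w : ℕ} (init : Basis I A w)
    (U : ℕ → Matrix.unitaryGroup (Basis I A w) ℂ) (T : ℕ) :
    ∑ b, ‖finalState x init U T b‖ ^ 2 = 1 := by
  induction T with
  | zero =>
    rw [finalState, sum_sq_mulVec, Finset.sum_eq_single init]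
    · simp
    · intro b _ hb
      simp [hb]
    · simp
  | succ T ih => rw [finalState, sum_sq_mulVec, sum_sq_applyQuery, ih]

/-- Outcome distribution of the measurement of the final state in the computational basis. -/
noncomputable def outcomes (x : I → A) {w : ℕ} (init : Basis I A w)
    (U : ℕ → Matrix.unitaryGroup (Basis I A w) ℂ) (T : ℕ) : PMF (Basis I A w) :=
  PMF.ofFintype (fun b => ENNReal.ofReal (‖finalState x init U T b‖ ^ 2)) (by
    rw [← ENNReal.ofReal_sum_of_nonneg (fun b _ => by positivity), sum_sq_finalState,
      ENNReal.ofReal_one])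

/-- Classical programs with quantum subroutines. A program either stops with a result, or runs
a quantum circuit with `T` queries and arbitrary input-independent unitaries `U 0, …, U T`,
measures, and continues in a way that depends on the outcome. -/
inductive Prog (I A : Type) [Fintype I] [DecidableEq I] [Fintype A] [DecidableEq A]
    (α : Type) : Type
  | ret (a : α) : Prog I A α
  | quantum (w T : ℕ) (init : Basis I A w) (U : ℕ → Matrix.unitaryGroup (Basis I A w) ℂ)
      (next : Basis I A w → Prog I A α) : Prog I A α

namespace Prog

/-- Sequential composition. -/
def bind {α β : Type} : Prog I A α → (α → Prog I A β) → Prog I A β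
  | ret a, f => f a
  | quantum w T init U next, f => quantum w T init U fun b => (next b).bind f

/-- Joint distribution of the result and the number of queries on input `x`. -/
noncomputable def run {α : Type} (x : I → A) : Prog I A α → PMF (α × ℕ)
  | ret a => PMF.pure (a, 0)
  | quantum _ T init U next =>
      (outcomes x init U T).bind fun b => (run x (next b)).map fun ω => (ω.1, ω.2 + T)

/-- One classical query to position `i`. -/
def query (i : I) : Prog I A A :=
  quantum 1 1 (i, 0, 0) (fun _ => 1) fun b => ret b.2.1

/-- The list of results of `k` independent executions. -/
def replicate {α : Type} (p : Prog I A α) : ℕ → Prog I A (List α)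
  | 0 => ret []
  | k + 1 => p.bind fun a => (replicate p k).bind fun l => ret (a :: l)

end Prog

end Circuits

end QQuery

/-! # Boolean circuits as directed acyclic graphs -/

inductive Gate
  | and
  | or
  | nand
  deriving DecidableEq

namespace Gate

def apply : Gate → List Bool → Bool
  | and, l => l.all id
  | or, l => l.any id
  | nand, l => !l.all id

/-- Encoding of a gate as an oracle answer. -/
def code : Gate → ℕ
  | and => 0
  | or => 1
  | nand => 2

def decode : ℕ → Gate
  | 0 => and
  | 1 => or
  | _ => nand

end Gate

/-- `b ^ σ`, that is `b ^ 1 = b` and `b ^ 0 = ¬ b`. -/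
def literal (b σ : Bool) : Bool := if σ then b else !b

/-- A circuit with vertices `Fin n`: a directed acyclic graph given by the lists `adj i` of
out-neighbours, without vertices of out-degree one, with a gate at each vertex (used only at the
non-sinks), a variable at each vertex (used only at the sinks), a label `σ i j` on each edge
`(i, j)` and a root. -/
structure Circuit (n : ℕ) where
  adj : Fin n → List (Fin n)
  nodup : ∀ i, (adj i).Nodup
  acyclic : ∀ i, ¬ Relation.TransGen (fun u v => v ∈ adj u) i i
  ne_one : ∀ i, (adj i).length ≠ 1
  gate : Fin n → Gate
  var : Fin n → ℕ
  σ : Fin n → Fin n → Bool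
  root : Fin n

/-- The number of non-sinks among the vertices, for given out-degrees. -/
def numNonsinks {n : ℕ} (deg : Fin n → ℕ) : ℕ := (Finset.univ.filter fun i => 0 < deg i).card

namespace Circuit

variable {n : ℕ} (G : Circuit n)

/-- Out-degree. -/
def deg (i : Fin n) : ℕ := (G.adj i).length

/-- The number of edges. -/
def m : ℕ := ∑ i, G.deg i

/-- The number of vertices with at least one outgoing edge. -/
def nhat : ℕ := numNonsinks G.deg

/-- All function vertices are labelled by NAND; negations are on the edges. -/
def IsNandNot : Prop := ∀ i, 0 < G.deg i → G.gate i ∈ ({Gate.nand} : Set Gate)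

/-- All function vertices are labelled by NAND, AND or OR; negations are on the edges. -/
def IsNandAndOrNot : Prop :=
  ∀ i, 0 < G.deg i → G.gate i ∈ ({Gate.nand, Gate.and, Gate.or} : Set Gate)

/-- Topologically sorted, with the sinks at the end. -/
def IsOrdered : Prop :=
  (∀ i, ∀ j ∈ G.adj i, i < j) ∧ ∀ i : Fin n, G.nhat ≤ i.val → G.deg i = 0

/-- There is a directed path (possibly of length zero) from `u` to `v`. -/
def Reachable (u v : Fin n) : Prop := Relation.ReflTransGen (fun u v => v ∈ G.adj u) u v

theorem wf : WellFounded fun j i => j ∈ G.adj i := by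
  let r : Fin n → Fin n → Prop := Relation.TransGen fun j i => j ∈ G.adj i
  have hirr : ∀ i, ¬ r i i := fun i h => G.acyclic i (Relation.transGen_swap.1 h)
  have : IsTrans (Fin n) r := ⟨fun _ _ _ => Relation.TransGen.trans⟩
  have : Std.Irrefl r := ⟨hirr⟩
  exact Subrelation.wf (fun h => Relation.TransGen.single h)
    (Finite.wellFounded_of_trans_of_irrefl r)

/-- The value `r_i` of a vertex under an assignment `x` of the variables. -/
noncomputable def value (x : ℕ → Bool) : Fin n → Bool :=
  G.wf.fix fun i r =>
    if G.deg i = 0 then x (G.var i)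
    else (G.gate i).apply ((G.adj i).attach.map fun j => literal (r j.1 j.2) (G.σ i j.1))

theorem value_eq (x : ℕ → Bool) (i : Fin n) :
    G.value x i = if G.deg i = 0 then x (G.var i)
      else (G.gate i).apply ((G.adj i).map fun j => literal (G.value x j) (G.σ i j)) := by
  conv_lhs => rw [value, WellFounded.fix_eq]
  have h : (G.adj i).attach.map (fun j => literal (G.value x j.1) (G.σ i j.1)) =
      (G.adj i).map fun j => literal (G.value x j) (G.σ i j) :=
    List.attach_map_val (f := fun j => literal (G.value x j) (G.σ i j))
  rw [← h]
  rfl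

end Circuit

/-! # The oracle

The algorithm knows the out-degrees; all the rest is accessed by queries. -/

/-- Positions of the input string: the gate of a vertex, the value of the variable of a vertex,
the end point and the label of the `k`-th edge out of a vertex (counted from zero). -/
inductive Query (n : ℕ)
  | gate (i : Fin n)
  | var (i : Fin n)
  | target (i k : Fin n)
  | label (i k : Fin n)
  deriving DecidableEq, Fintype

/-- Every answer is a number less than `n + 2`. -/
abbrev Answer (n : ℕ) : Type := Fin (n + 2)

/-- Quantum query programs on circuits with `n` vertices. -/
abbrev CProg (n : ℕ) (α : Type) : Type := QQuery.Prog (Query n) (Answer n) α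

/-- The input string of a circuit and an assignment. Positions that hold nothing (such as an edge
number that is too large) contain zero. -/
def Circuit.oracle {n : ℕ} (G : Circuit n) (x : ℕ → Bool) : Query n → Answer n
  | .gate i => Fin.ofNat _ (if G.deg i = 0 then 0 else (G.gate i).code)
  | .var i => Fin.ofNat _ (if G.deg i = 0 then (x (G.var i)).toNat else 0)
  | .target i k => Fin.ofNat _ (((G.adj i)[k.val]?.map Fin.val).getD 0)
  | .label i k => Fin.ofNat _ (((G.adj i)[k.val]?.map fun j => (G.σ i j).toNat).getD 0)

/-- The classical query of the end point of the `k`-th edge out of `i`. -/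
def getTarget {n : ℕ} (i k : Fin n) : CProg n (Fin n) :=
  (QQuery.Prog.query (Query.target i k)).bind fun a =>
    .ret (if h : a.val < n then ⟨a.val, h⟩ else i)

def getGate {n : ℕ} (i : Fin n) : CProg n Gate :=
  (QQuery.Prog.query (Query.gate i)).bind fun a => .ret (Gate.decode a.val)

def getVar {n : ℕ} (i : Fin n) : CProg n Bool :=
  (QQuery.Prog.query (Query.var i)).bind fun a => .ret (a.val == 1)

/-! # The quantum subroutines -/

/-- The two quantum subroutines, as query programs; `deg` is the list of out-degrees.
* `firstOne deg visited i start` looks for the first position `z ≥ start` in the list of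
  out-neighbours of `i` that holds a non-visited non-sink (positions are counted from zero);
* `search deg t i b` looks for an argument of the gate at `i` that is equal to `b`, where `t` is
  the table of the values computed so far. -/
structure Subroutines where
  firstOne : {n : ℕ} → (deg : Fin n → ℕ) → (visited : Fin n → Bool) → (i : Fin n) →
    (start : ℕ) → CProg n (Option (Fin n))
  search : {n : ℕ} → (deg : Fin n → ℕ) → (t : Fin n → Bool) → (i : Fin n) → (b : Bool) →
    CProg n (Option (Fin n))

namespace Circuit

variable {n : ℕ} (G : Circuit n)

/-- Position `k` of the list of out-neighbours of `i` holds a non-visited non-sink. -/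
def Fresh (visited : Fin n → Bool) (i k : Fin n) : Prop :=
  ∃ j, (G.adj i)[k.val]? = some j ∧ visited j = false ∧ 0 < G.deg j

/-- `z` is the first position at least `start` that holds a non-visited non-sink, or `none` if
there is no such position. -/
def IsFirstFresh (visited : Fin n → Bool) (i : Fin n) (start : ℕ) : Option (Fin n) → Prop
  | none => ∀ k : Fin n, start ≤ k.val → ¬ G.Fresh visited i k
  | some z => start ≤ z.val ∧ G.Fresh visited i z ∧
      ∀ k : Fin n, start ≤ k.val → k < z → ¬ G.Fresh visited i k

/-- The number of positions that are passed by a search that starts at `start` in the list of `i`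
and ends with the given result. -/
noncomputable def passed (i : Fin n) (start : ℕ) : Option (Fin n) → ℝ
  | none => (G.deg i : ℝ) - start
  | some z => (z.val : ℝ) + 1 - start

/-- The value `t_f(j)`: the variable at a sink, and the entry of the table elsewhere. -/
def tableValue (x : ℕ → Bool) (t : Fin n → Bool) (j : Fin n) : Bool :=
  if G.deg j = 0 then x (G.var j) else t j

/-- The `k`-th argument of the gate at `i`, computed from the table `t`, is equal to `b`. -/
def ArgEq (x : ℕ → Bool) (t : Fin n → Bool) (i : Fin n) (b : Bool) (k : Fin n) : Prop :=
  ∃ j, (G.adj i)[k.val]? = some j ∧ literal (G.tableValue x t j) (G.σ i j) = b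

end Circuit

/-- `firstOne` has error probability at most `1 / n̂ ^ 2`, and it makes at most
`c √(z - start) log n̂` queries, where `z - start` is the number of passed positions. -/
def Subroutines.FirstOneSpec (S : Subroutines) (c : ℝ) : Prop :=
  ∀ {n : ℕ} (G : Circuit n) (x : ℕ → Bool) (visited : Fin n → Bool) (i : Fin n) (start : ℕ),
    2 ≤ G.nhat →
    (∀ ω ∈ ((S.firstOne G.deg visited i start).run (G.oracle x)).support,
      (ω.2 : ℝ) ≤ c * √(G.passed i start ω.1) * Real.log G.nhat) ∧
    ((S.firstOne G.deg visited i start).run (G.oracle x)).toOuterMeasure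
      {ω | ¬ G.IsFirstFresh visited i start ω.1} ≤ ENNReal.ofReal (1 / (G.nhat : ℝ) ^ 2)

/-- `search` makes at most `c √d_i` queries and has one-sided error: what it finds is always
right, and it misses an existing element with probability at most `1 / 2`. -/
def Subroutines.SearchSpec (S : Subroutines) (c : ℝ) : Prop :=
  ∀ {n : ℕ} (G : Circuit n) (x : ℕ → Bool) (t : Fin n → Bool) (i : Fin n) (b : Bool),
    (∀ ω ∈ ((S.search G.deg t i b).run (G.oracle x)).support,
      (ω.2 : ℝ) ≤ c * √(G.deg i) ∧ ∀ z ∈ ω.1, G.ArgEq x t i b z) ∧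
    ((∃ k, G.ArgEq x t i b k) →
      ((S.search G.deg t i b).run (G.oracle x)).toOuterMeasure {ω | ω.1 = none} ≤ 1 / 2)

/-! # The algorithm -/

namespace Subroutines

variable (S : Subroutines) {n : ℕ} (deg : Fin n → ℕ)

/-- The state of the depth-first search: the array `visited` and the list `order`. -/
structure DFSState (n : ℕ) where
  visited : Fin n → Bool
  order : List (Fin n)

/-- The loop of the depth-first search at the vertex `i`: find the next non-visited non-sink,
process it by `rec`, continue behind it. The first number bounds the number of rounds. -/
def scan (rec : Fin n → DFSState n → CProg n (DFSState n)) (i : Fin n) :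
    ℕ → ℕ → DFSState n → CProg n (DFSState n)
  | 0, _, st => .ret st
  | rounds + 1, start, st =>
      (S.firstOne deg st.visited i start).bind fun r =>
        match r with
        | none => .ret st
        | some z => (getTarget i z).bind fun j => (rec j st).bind fun st' =>
            scan rec i rounds (z.val + 1) st'

/-- The depth-first search from `i` that puts each non-sink on top of `order` after its
descendants. The number bounds the depth of the recursion. -/
def topSortDFS : ℕ → Fin n → DFSState n → CProg n (DFSState n)
  | 0, _, st => .ret st
  | depth + 1, i, st =>
      let st₁ : DFSState n := ⟨Function.update st.visited i true, st.order⟩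
      if 0 < deg i then
        (scan S deg (topSortDFS depth) i (n + 1) 0 st₁).bind fun st₂ =>
          .ret ⟨st₂.visited, i :: st₂.order⟩
      else .ret st₁

/-- Topological sort by depth-first searches from the vertices of a list. Paths and out-degrees
are shorter than the bounds on depth and rounds. -/
def topSortFrom : List (Fin n) → DFSState n → CProg n (DFSState n)
  | [], st => .ret st
  | i :: l, st =>
      if st.visited i then topSortFrom l st
      else (topSortDFS S deg (n + 1) i st).bind fun st' => topSortFrom l st'

def topSort (starts : List (Fin n)) : CProg n (List (Fin n)) :=
  (topSortFrom S deg starts ⟨fun _ => false, []⟩).bind fun st => .ret st.order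

/-- The quantum algorithm for one gate: for AND and NAND search for a `0` among the arguments,
for OR search for a `1`. -/
def gateAlg (h : Gate) (t : Fin n → Bool) (i : Fin n) : CProg n Bool :=
  match h with
  | .and => (S.search deg t i false).bind fun r => .ret r.isNone
  | .or => (S.search deg t i true).bind fun r => .ret r.isSome
  | .nand => (S.search deg t i false).bind fun r => .ret r.isSome

/-- The classical combination of the results of the repetitions; the error of `gateAlg` is on
the side of `1` for AND, and on the side of `0` for OR and NAND. -/
def combine (h : Gate) (l : List Bool) : Bool :=
  match h with
  | .and => l.all id
  | .or => l.any id
  | .nand => l.any id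

/-- The boosted algorithm for one gate, with `k` repetitions. -/
def boosted (k : ℕ) (h : Gate) (t : Fin n → Bool) (i : Fin n) : CProg n Bool :=
  ((gateAlg S deg h t i).replicate k).bind fun l => .ret (combine h l)

/-- The main loop: compute the values of the listed vertices one by one, until `s` is done. -/
noncomputable def evalLoop (s : Fin n) : List (Fin n) → (Fin n → Bool) → CProg n (Fin n → Bool)
  | [], t => .ret t
  | i :: l, t =>
      (getGate i).bind fun h =>
        (boosted S deg ⌈2 * Real.logb 2 (numNonsinks deg)⌉₊ h t i).bind fun b =>
          if i = s then .ret (Function.update t i b)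
          else evalLoop s l (Function.update t i b)

/-- The whole algorithm for the root `s`. If `ordered` is set, the graph is taken as ordered, so
that the non-sinks are the first `n̂` vertices; otherwise it is sorted by searches from `starts`.
The vertices are processed from the last one of the order down to `s`. The result is the table
entry of `s`, or its variable if `s` is a sink. -/
noncomputable def algorithm (ordered : Bool) (starts : List (Fin n)) (s : Fin n) : CProg n Bool :=
  (if ordered then .ret ((List.finRange n).take (numNonsinks deg))
    else topSort S deg starts).bind fun order =>
  (evalLoop S deg s order.reverse fun _ => false).bind fun t =>
  if deg s = 0 then getVar s else .ret (t s)

end Subroutines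

/-! The proof separates two kinds of statement about a program. `Prog.Ensures` speaks of every
outcome of positive probability and carries all running times. `Prog.errProb` bounds the probability
of leaving a given set of results and carries all error bounds. Both compose along `bind`: query
counts add, errors obey a union bound, and the failure probabilities of repeated searches multiply.

Quantum search. Grover's iteration rotates the state by `2θ` in the plane of marked and unmarked
positions. The number of marked positions is unknown, so the angles `3 ^ ℓ * θ` are tried for all
relevant `ℓ`. One of them lies between `π / 6` and `π / 2` and succeeds with probability at least `1
/ 4`, and the geometric series of costs is `O(√N)` (`ensures_sweep`, `errProb_sweep_le`). Each
measured position is tested by classical queries, so the search never reports a wrong position.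

First element. Windows of doubling length are searched until one contains an element, and binary
search then finds the first element in that window. The reliability parameter grows by one at each
halving, so the errors form a geometric series, while the costs decrease geometrically with the
interval length (`ensures_window`, `errProb_window_le`).

Running time of the sort. Since the search reports only non-visited non-sinks, even an erroneous run
visits each non-sink at most once. By the AM-GM inequality a search that passes `p` positions costs
at most `K / 2 * (l + p / l)` for any fixed `l > 0`, where `K = O(log n̂)`. The passed positions in
one list add up to at most its length, and there are at most two searches per visited non-sink: the
one that discovers it and the last one in its own list. Hence the total is about `K / 2 * (2 * n̂ *
l + m / l)`, which for `l = √(m / n̂)` is `O(√(n̂ m) log n̂)`. This is organized as an amortized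
analysis with `potential`. The credit of a vertex also includes the cost of its later evaluation,
which is `O(√d_i log n̂)` and is treated by the same inequality.

Correctness. If all searches answer correctly, the run is deterministic. The lemmas `exists_topSort`
and `exists_evalLoop` follow this ideal run and bound the probability of departing from it. It
contains at most `2 * n̂` searches for a first element and `n̂` gate evaluations, each with error at
most `1 / n̂ ^ 2`, which gives `3 / n̂`. That the ideal order is topological follows from
acyclicity: a child that is visited but unfinished would be an ancestor. -/

namespace QQuery

open scoped ENNReal

section

variable {I A : Type} [Fintype I] [DecidableEq I] [Fintype A] [DecidableEq A] [AddCommGroup A]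

/-! ### Calculus of worst-case query counts and error probabilities. -/

namespace Prog

theorem run_bind {α β : Type} (x : I → A) (p : Prog I A α) (f : α → Prog I A β) :
    (p.bind f).run x =
      (p.run x).bind fun ω => ((f ω.1).run x).map fun ω' => (ω'.1, ω.2 + ω'.2) := by
  induction p with
  | ret a => simp [bind, run, PMF.pure_bind]; exact (PMF.map_id _).symm
  | quantum w T init U next ih =>
    simp only [bind, run, PMF.bind_bind, PMF.bind_map, PMF.map_bind, ih, PMF.map_comp]
    congr 1
    funext b
    congr 1
    funext ω
    simp only [Function.comp_def]
    congr 1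
    funext ω'
    simp [add_right_comm]

/-- Every possible outcome with result `a` after `q` queries satisfies `Q a q`. -/
def Ensures {α : Type} (x : I → A) (p : Prog I A α) (Q : α → ℕ → Prop) : Prop :=
  ∀ ω ∈ (p.run x).support, Q ω.1 ω.2

/-- The probability that the result is not in `S`. -/
noncomputable def errProb {α : Type} (x : I → A) (p : Prog I A α) (S : Set α) : ℝ≥0∞ :=
  (p.run x).toOuterMeasure {ω | ω.1 ∉ S}

variable {α β : Type} {x : I → A}

theorem ensures_ret {a : α} {Q : α → ℕ → Prop} (h : Q a 0) : (ret a : Prog I A α).Ensures x Q := by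
  intro ω hω
  simp only [run, PMF.support_pure, Set.mem_singleton_iff] at hω
  subst hω
  exact h

theorem Ensures.bind {p : Prog I A α} {f : α → Prog I A β} {Q : α → ℕ → Prop}
    {R : β → ℕ → Prop} (hp : p.Ensures x Q)
    (hf : ∀ a q, Q a q → (f a).Ensures x fun b q' => R b (q + q')) :
    (p.bind f).Ensures x R := by
  intro ω hω
  simp only [run_bind, PMF.mem_support_bind_iff, PMF.support_map, Set.mem_image] at hω
  obtain ⟨ω₁, h₁, ω₂, h₂, rfl⟩ := hω
  exact hf _ _ (hp _ h₁) _ h₂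

theorem Ensures.mono {p : Prog I A α} {Q R : α → ℕ → Prop} (hp : p.Ensures x Q)
    (h : ∀ a q, Q a q → R a q) : p.Ensures x R :=
  fun ω hω => h _ _ (hp ω hω)

theorem errProb_le_one (p : Prog I A α) (S : Set α) : p.errProb x S ≤ 1 := by
  refine (MeasureTheory.measure_mono (Set.subset_univ _)).trans ?_
  exact le_of_eq ((PMF.toOuterMeasure_apply_eq_one_iff _ _).2 (Set.subset_univ _))

theorem errProb_eq_zero {p : Prog I A α} {S : Set α} (h : p.Ensures x fun a _ => a ∈ S) :
    p.errProb x S = 0 := by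
  rw [errProb, PMF.toOuterMeasure_apply_eq_zero_iff, Set.disjoint_left]
  exact fun ω hω hn => hn (h ω hω)

theorem errProb_ret {a : α} {S : Set α} (h : a ∈ S) : (ret a : Prog I A α).errProb x S = 0 :=
  errProb_eq_zero (ensures_ret h)

/-- Condition on the result of `p`: a bad first result costs at most `δ`, a good one at most `ε`.
With `δ = 1` this is the union bound; with `ε = 0` it multiplies the failure probabilities of
repeated attempts. `Q` supplies what is known about all possible first results. -/
theorem errProb_bind_le {p : Prog I A α} {f : α → Prog I A β} {S : Set α} {T : Set β}
    {Q : α → ℕ → Prop} (hQ : p.Ensures x Q) {δ ε : ℝ≥0∞}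
    (hδ : ∀ a q, Q a q → a ∉ S → (f a).errProb x T ≤ δ)
    (hε : ∀ a q, Q a q → a ∈ S → (f a).errProb x T ≤ ε) :
    (p.bind f).errProb x T ≤ p.errProb x S * δ + ε := by
  classical
  have h1 : (p.bind f).errProb x T = ∑' ω, p.run x ω * (f ω.1).errProb x T := by
    rw [errProb, run_bind, PMF.toOuterMeasure_bind_apply]
    refine tsum_congr fun ω => ?_
    rw [PMF.toOuterMeasure_map_apply]
    rfl
  rw [h1, errProb, PMF.toOuterMeasure_apply, ← ENNReal.tsum_mul_right]
  calc ∑' ω, p.run x ω * (f ω.1).errProb x T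
      ≤ ∑' ω, (Set.indicator {ω | ω.1 ∉ S} (p.run x) ω * δ + p.run x ω * ε) := by
        refine ENNReal.tsum_le_tsum fun ω => ?_
        by_cases hω : ω ∈ (p.run x).support
        · by_cases hS : ω.1 ∈ S
          · exact (mul_le_mul_right (hε _ _ (hQ ω hω) hS) _).trans le_add_self
          · have : ω ∈ {ω : α × ℕ | ω.1 ∉ S} := hS
            rw [Set.indicator_of_mem this]
            exact (mul_le_mul_right (hδ _ _ (hQ ω hω) hS) _).trans le_self_add
        · rw [PMF.apply_eq_zero_iff _ _ |>.2 hω]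
          simp
    _ = _ := by
        rw [ENNReal.tsum_add, ENNReal.tsum_mul_right (a := ε), PMF.tsum_coe, one_mul]

theorem errProb_bind_le_add {p : Prog I A α} {f : α → Prog I A β} {S : Set α} {T : Set β}
    {Q : α → ℕ → Prop} (hQ : p.Ensures x Q) {ε : ℝ≥0∞}
    (hε : ∀ a q, Q a q → a ∈ S → (f a).errProb x T ≤ ε) :
    (p.bind f).errProb x T ≤ p.errProb x S + ε := by
  simpa using errProb_bind_le hQ (δ := 1) (fun _ _ _ _ => errProb_le_one _ _) hε

/-- The form used to follow one ideal run: either `p` departs from the intended result `a`, or the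
error occurs in the continuation from `a`. -/
theorem errProb_bind_singleton {p : Prog I A α} {f : α → Prog I A β} {T : Set β} (a : α) :
    (p.bind f).errProb x T ≤ p.errProb x {a} + (f a).errProb x T :=
  errProb_bind_le_add (Q := fun _ _ => True) (fun _ _ => trivial)
    (by rintro _ _ - rfl; exact le_rfl)

theorem run_query (x : I → A) (i : I) : (query i).run x = PMF.pure (x i, 1) := by
  have hs : finalState x ((i, 0, 0) : Basis I A 1) (fun _ => 1) 1 = Pi.single (i, x i, 0) 1 := by
    funext b
    obtain ⟨j, z, k⟩ := b
    simp only [finalState, Submonoid.coe_one, Matrix.one_mulVec, applyQuery,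
      Pi.single_apply, Prod.mk.injEq]
    by_cases hj : j = i
    · subst hj; simp [sub_eq_zero]
    · simp [hj]
  have ho : outcomes x ((i, 0, 0) : Basis I A 1) (fun _ => 1) 1 = PMF.pure (i, x i, 0) := by
    ext b
    simp only [outcomes, PMF.ofFintype_apply, hs, PMF.pure_apply, Pi.single_apply]
    split_ifs <;> simp
  simp only [query, run, ho, PMF.pure_bind, PMF.pure_map]

theorem ensures_query_bind {i : I} {f : A → Prog I A α} {Q : α → ℕ → Prop}
    (h : (f (x i)).Ensures x fun a q => Q a (1 + q)) : ((query i).bind f).Ensures x Q := by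
  refine Ensures.bind (Q := fun a q => a = x i ∧ q = 1) ?_ ?_
  · intro ω hω
    rw [run_query, PMF.support_pure, Set.mem_singleton_iff] at hω
    simp [hω]
  · rintro _ _ ⟨rfl, rfl⟩
    exact h

theorem errProb_query_bind {i : I} {f : A → Prog I A α} {T : Set α} :
    ((query i).bind f).errProb x T ≤ (f (x i)).errProb x T := by
  refine (errProb_bind_singleton (x i)).trans (le_of_eq ?_)
  rw [errProb_eq_zero, zero_add]
  intro ω hω
  rw [run_query, PMF.support_pure, Set.mem_singleton_iff] at hω
  simp [hω]

/-- Run the programs of a list one by one until one of them finds something. -/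
def firstSome {ι : Type} (f : ι → Prog I A (Option α)) : List ι → Prog I A (Option α)
  | [] => ret none
  | i :: l => (f i).bind fun r =>
      match r with
      | none => firstSome f l
      | some a => ret (some a)

theorem ensures_firstSome {ι : Type} {f : ι → Prog I A (Option α)} {c : ι → ℝ} {P : α → Prop}
    (l : List ι) (hc : ∀ i, 0 ≤ c i)
    (h : ∀ i ∈ l, (f i).Ensures x fun r q => (q : ℝ) ≤ c i ∧ ∀ a ∈ r, P a) :
    (firstSome f l).Ensures x fun r q => (q : ℝ) ≤ (l.map c).sum ∧ ∀ a ∈ r, P a := by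
  induction l with
  | nil => exact ensures_ret (by simp)
  | cons i l ih =>
    refine (h i (by simp)).bind ?_
    rintro (_ | a) q ⟨hq, ha⟩
    · refine (ih fun j hj => h j (by simp [hj])).mono ?_
      rintro r q' ⟨hq', hr⟩
      refine ⟨?_, hr⟩
      push_cast
      simp only [List.map_cons, List.sum_cons]
      linarith
    · refine ensures_ret ⟨?_, by simpa using ha a rfl⟩
      have : 0 ≤ (l.map c).sum := List.sum_nonneg (by simpa using fun j _ => hc j)
      simp only [List.map_cons, List.sum_cons]
      push_cast
      linarith

/-- `errProb` with respect to `{none}ᶜ` is the probability of finding nothing, and the list finds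
nothing only if all its programs fail. -/
theorem errProb_firstSome_le {ι : Type} {f : ι → Prog I A (Option α)} (l : List ι) :
    (firstSome f l).errProb x {none}ᶜ ≤ (l.map fun i => (f i).errProb x {none}ᶜ).prod := by
  induction l with
  | nil => simpa using errProb_le_one _ _
  | cons i l ih =>
    refine (errProb_bind_le (S := {none}ᶜ) (Q := fun _ _ => True) (fun _ _ => trivial)
      (δ := (l.map fun i => (f i).errProb x {none}ᶜ).prod) (ε := 0) ?_ ?_).trans ?_
    · rintro (_ | a) q - ha
      · exact ih
      · simp at ha
    · rintro (_ | a) q - ha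
      · simp at ha
      · exact le_of_eq (errProb_ret (by simp))
    · simp

end Prog

end

/-! ### Reflections and signed permutations as unitaries. -/

theorem star_dotProduct_self_real {B : Type} [Fintype B] (v : B → ℂ) :
    star (star v ⬝ᵥ v) = star v ⬝ᵥ v := by
  rw [← Matrix.star_dotProduct_star, star_star]

section Unitaries

variable {B K : Type} [DecidableEq B] [Fintype K]

/-- The state `∑ k, α k |g k⟩`. -/
noncomputable def push (g : K → B) (α : K → ℝ) : B → ℂ :=
  ∑ k, (α k : ℂ) • Pi.single (g k) 1

theorem push_apply [DecidableEq K] {g : K → B} (hg : Function.Injective g) (α : K → ℝ) (k : K) :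
    push g α (g k) = α k := by
  simp only [push, Finset.sum_apply, Pi.smul_apply, Pi.single_apply, hg.eq_iff, smul_eq_mul,
    mul_ite, mul_one, mul_zero]
  simp

theorem push_apply_of_notMem {g : K → B} (α : K → ℝ) {b : B} (hb : b ∉ Set.range g) :
    push g α b = 0 := by
  simp only [push, Finset.sum_apply, Pi.smul_apply, Pi.single_apply, smul_eq_mul]
  refine Finset.sum_eq_zero fun k _ => ?_
  rw [if_neg fun h => hb ⟨k, h.symm⟩, mul_zero]

variable [Fintype B]

/-- The reflection about the line spanned by `v`. -/
noncomputable def reflection (v : B → ℂ) : Matrix.unitaryGroup B ℂ :=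
  ⟨(2 / (star v ⬝ᵥ v)) • Matrix.vecMulVec v (star v) - 1, by
    set s := star v ⬝ᵥ v with hs
    have hstar : star ((2 / s) • Matrix.vecMulVec v (star v) - 1) =
        (2 / s) • Matrix.vecMulVec v (star v) - 1 := by
      rw [star_sub, star_smul, star_one, Matrix.star_eq_conjTranspose,
        Matrix.conjTranspose_vecMulVec, star_star, star_div₀, hs, star_dotProduct_self_real]
      simp
    rw [Matrix.mem_unitaryGroup_iff, hstar, sub_mul, mul_sub, smul_mul_smul_comm,
      Matrix.vecMulVec_mul_vecMulVec, ← hs]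
    simp only [mul_one, one_mul, Matrix.vecMulVec_smul, smul_smul]
    have h2 : 2 / s * (2 / s) * s = 2 / s + 2 / s := by
      -- For `v = 0` the coefficient is `2 / 0 = 0`, and the matrix is `-1`, which is still unitary.
      rcases eq_or_ne s 0 with h | h
      · simp [h]
      · field_simp; norm_num
    rw [h2, add_smul]
    abel⟩

theorem reflection_mulVec (v ψ : B → ℂ) :
    (reflection v).1.mulVec ψ = (2 * (star v ⬝ᵥ ψ) / (star v ⬝ᵥ v)) • v - ψ := by
  simp only [reflection, Matrix.sub_mulVec, Matrix.smul_mulVec, Matrix.one_mulVec,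
    Matrix.vecMulVec_mulVec]
  congr 1
  funext b
  simp
  ring

/-- The unitary `|b⟩ ↦ ± |e b⟩`, with a minus sign where `φ b` holds. -/
def signedPerm (e : Equiv.Perm B) (φ : B → Bool) : Matrix.unitaryGroup B ℂ :=
  ⟨Matrix.of fun b b' => if e b' = b then (if φ b' then -1 else 1) else 0, by
    rw [Matrix.mem_unitaryGroup_iff']
    ext b b'
    simp only [Matrix.mul_apply, Matrix.star_apply, Matrix.of_apply, Matrix.one_apply]
    rw [Finset.sum_eq_single (e b)]
    · by_cases h : b = b'
      · subst h; cases φ b <;> simp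
      · have : e b' ≠ e b := fun h' => h (e.injective h').symm
        simp [h, this]
    · intro c _ hc
      simp [hc.symm]
    · simp⟩

theorem signedPerm_mulVec_single (e : Equiv.Perm B) (φ : B → Bool) (b : B) :
    (signedPerm e φ).1.mulVec (Pi.single b 1) =
      (if φ b then -1 else 1 : ℂ) • Pi.single (e b) 1 := by
  rw [Matrix.mulVec_single_one]
  funext c
  simp only [signedPerm, Matrix.col_apply, Matrix.of_apply, Pi.smul_apply, Pi.single_apply,
    smul_eq_mul, eq_comm (a := c)]
  split_ifs <;> simp

theorem signedPerm_mulVec_push (e : Equiv.Perm B) (φ : B → Bool) (g : K → B) (α : K → ℝ) :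
    (signedPerm e φ).1.mulVec (push g α) =
      push (fun k => e (g k)) fun k => if φ (g k) then -α k else α k := by
  simp only [push, Matrix.mulVec_sum, Matrix.mulVec_smul, signedPerm_mulVec_single, smul_smul]
  refine Finset.sum_congr rfl fun k _ => ?_
  split_ifs <;> simp

theorem star_push_dotProduct_push [DecidableEq K] {g : K → B} (hg : Function.Injective g)
    (α β : K → ℝ) : star (push g α) ⬝ᵥ push g β = ((∑ k, α k * β k : ℝ) : ℂ) := by
  rw [dotProduct, ← Fintype.sum_of_injective g hg (fun k => ((α k * β k : ℝ) : ℂ))]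
  · push_cast; rfl
  · intro b hb
    simp [push_apply_of_notMem _ hb]
  · intro k
    simp [push_apply hg]

end Unitaries

theorem applyQuery_push {I A : Type} [Fintype I] [DecidableEq I] [Fintype A] [DecidableEq A]
    [AddCommGroup A] {K : Type} [Fintype K] (x : I → A) {w : ℕ} (g : K → Basis I A w)
    (α : K → ℝ) :
    applyQuery x (push g α) =
      push (fun k => ((g k).1, (g k).2.1 + x (g k).1, (g k).2.2)) α := by
  funext b
  simp only [applyQuery, push, Finset.sum_apply, Pi.smul_apply]
  refine Finset.sum_congr rfl fun k _ => ?_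
  congr 1
  simp only [Pi.single_apply]
  congr 1
  obtain ⟨q, z, v⟩ := b
  simp only [Prod.ext_iff, eq_iff_iff]
  constructor
  · rintro ⟨h1, h2, h3⟩
    subst h1
    exact ⟨rfl, by simp [← h2], h3⟩
  · rintro ⟨h1, h2, h3⟩
    subst h1
    exact ⟨rfl, by simp [h2], h3⟩

/-! ### Grover's algorithm as a query circuit. -/

namespace Grover

variable {n : ℕ}

/-- The vertex that is encoded by an answer, as in `getTarget`. -/
def toVertex (i : Fin n) (a : Answer n) : Fin n := if h : a.val < n then ⟨a.val, h⟩ else i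

/-- Work space: a position in a list of out-neighbours and a stored answer. -/
abbrev State (n : ℕ) : Type := Basis (Query n) (Answer n) (n * (n + 2))

def state (q : Query n) (z : Answer n) (k : Fin n) (y : Answer n) : State n :=
  (q, z, finProdFinEquiv (k, y))

def position (b : State n) : Fin n := (finProdFinEquiv.symm b.2.2).1

def stored (b : State n) : Answer n := (finProdFinEquiv.symm b.2.2).2

@[simp] theorem position_state (q : Query n) (z : Answer n) (k : Fin n) (y : Answer n) :
    position (state q z k y) = k := by simp [position, state]

@[simp] theorem stored_state (q : Query n) (z : Answer n) (k : Fin n) (y : Answer n) :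
    stored (state q z k y) = y := by simp [stored, state]

theorem state_eta (b : State n) : state b.1 b.2.1 (position b) (stored b) = b := by
  simp only [state, position, stored, Prod.mk.eta, Equiv.apply_symm_apply]

/-- Exchange the answer with the stored one, and the query of an end point with the query of the
label of the same edge. -/
def exchange (i : Fin n) : Equiv.Perm (State n) :=
  Function.Involutive.toPerm
    (fun b => state (Equiv.swap (.target i (position b)) (.label i (position b)) b.1) (stored b)
      (position b) b.2.1) (by
    intro b
    simp only [position_state, stored_state]
    conv_rhs => rw [← state_eta b]
    simp [state])

/-- Exchange the query of a label with the query of the variable at the stored vertex. -/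
def redirect (i : Fin n) : Equiv.Perm (State n) :=
  Function.Involutive.toPerm
    (fun b => state (Equiv.swap (.label i (position b)) (.var (toVertex i (stored b))) b.1) b.2.1
      (position b) (stored b)) (by
    intro b
    simp only [position_state, stored_state]
    conv_rhs => rw [← state_eta b]
    simp [state])

/-- A query adds the oracle answer. After negation of the answer register, the same query cancels
what was added before, so no inverse query is needed. -/
def negate : Equiv.Perm (State n) :=
  Function.Involutive.toPerm (fun b => (b.1, -b.2.1, b.2.2)) (fun b => by simp)

@[simp] theorem exchange_target (i k : Fin n) (z y : Answer n) :
    exchange i (state (.target i k) z k y) = state (.label i k) y k z := by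
  simp [exchange, Function.Involutive.toPerm]; simp [state]

@[simp] theorem exchange_label (i k : Fin n) (z y : Answer n) :
    exchange i (state (.label i k) z k y) = state (.target i k) y k z := by
  simp [exchange, Function.Involutive.toPerm]; simp [state]

@[simp] theorem redirect_label (i k : Fin n) (z y : Answer n) :
    redirect i (state (.label i k) z k y) = state (.var (toVertex i y)) z k y := by
  simp [redirect, Function.Involutive.toPerm]; simp [state]

@[simp] theorem redirect_var (i k : Fin n) (z y : Answer n) :
    redirect i (state (.var (toVertex i y)) z k y) = state (.label i k) z k y := by
  simp [redirect, Function.Involutive.toPerm]; simp [state]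

@[simp] theorem negate_state (q : Query n) (k : Fin n) (z y : Answer n) :
    negate (state q z k y) = state q (-z) k y := rfl

theorem applyQuery_state (o : Query n → Answer n) (q : Fin n → Query n) (z : Fin n → Answer n)
    (y : Fin n → Answer n) (α : Fin n → ℝ) :
    applyQuery o (push (fun k => state (q k) (z k) k (y k)) α) =
      push (fun k => state (q k) (z k + o (q k)) k (y k)) α :=
  applyQuery_push _ _ _

/-- The basis state that represents a position. -/
def home (i k : Fin n) : State n := state (.target i k) 0 k 0

theorem home_injective (i : Fin n) : Function.Injective (home i) := fun k k' h => by
  simpa [home] using congrArg position h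

/-- The indicator function of `P`, as a state. -/
noncomputable def uniform (i : Fin n) (P : Finset (Fin n)) (c : ℝ) : State n → ℂ :=
  push (home i) fun k => if k ∈ P then c else 0

/-- The gate query makes this vector orthogonal to all the vectors `home i k`. -/
def start (i : Fin n) : State n := state (.gate i) 0 i 0

/-- The unitaries of Grover's algorithm for the search in the set `P` of positions in the list of
`i`. The predicate `mark` is applied to the end point of an edge and the sum of its label and of
the variable at its end point. -/
noncomputable def unitaries (i : Fin n) (P : Finset (Fin n)) (mark : Fin n → Answer n → Bool) :
    ℕ → Matrix.unitaryGroup (State n) ℂ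
  | 0 => reflection (Pi.single (start i) 1 + uniform i P (1 / √P.card))
  | t + 1 =>
    match t % 6 with
    | 0 => signedPerm (exchange i) fun _ => false
    | 1 => signedPerm (redirect i) fun _ => false
    | 2 => signedPerm negate fun b => mark (toVertex i (stored b)) b.2.1
    | 3 => signedPerm (redirect i) fun _ => false
    | 4 => signedPerm ((exchange i).trans negate) fun _ => false
    | _ => reflection (uniform i P 1)

variable (o : Query n → Answer n) (i : Fin n) (P : Finset (Fin n))
  (mark : Fin n → Answer n → Bool)

/-- The position holds an edge that satisfies `mark`. -/
def Marked (k : Fin n) : Prop :=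
  mark (toVertex i (o (.target i k)))
    (o (.label i k) + o (.var (toVertex i (o (.target i k))))) = true

instance : DecidablePred (Marked o i mark) := fun _ => inferInstanceAs (Decidable (_ = true))

/-- One iteration: change the signs at the marked positions, then reflect about the mean. -/
noncomputable def iterate (α : Fin n → ℝ) (k : Fin n) : ℝ :=
  (if k ∈ P then 2 * (∑ k ∈ P, if Marked o i mark k then -α k else α k) / P.card else 0) -
    if Marked o i mark k then -α k else α k

noncomputable def amplitudes : ℕ → Fin n → ℝ
  | 0 => fun k => if k ∈ P then 1 / √P.card else 0
  | j + 1 => iterate o i P mark (amplitudes j)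

theorem reflection_uniform (α : Fin n → ℝ) :
    (reflection (uniform i P 1)).1.mulVec (push (home i) α) =
      push (home i) fun k => (if k ∈ P then 2 * (∑ k ∈ P, α k) / P.card else 0) - α k := by
  rw [reflection_mulVec, uniform, star_push_dotProduct_push (home_injective i),
    star_push_dotProduct_push (home_injective i)]
  simp only [push, ← Finset.sum_sub_distrib, Finset.smul_sum, smul_smul]
  refine Finset.sum_congr rfl fun k _ => ?_
  rw [← sub_smul]
  congr 1
  split_ifs <;> simp

/-- Two orthogonal unit vectors are exchanged by the reflection about the line spanned by their sum.
-/
theorem reflection_start (hP : P.Nonempty) :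
    (reflection (Pi.single (start i) 1 + uniform i P (1 / √P.card))).1.mulVec
      (Pi.single (start i) 1) = uniform i P (1 / √P.card) := by
  have hc : (0 : ℝ) < P.card := by exact_mod_cast hP.card_pos
  have h0 : uniform i P (1 / √P.card) (start i) = 0 := by
    refine push_apply_of_notMem _ ?_
    rintro ⟨k, hk⟩
    simpa [home, start, state] using congrArg Prod.fst hk
  have h1 : star (uniform i P (1 / √P.card)) ⬝ᵥ uniform i P (1 / √P.card) = 1 := by
    rw [uniform, star_push_dotProduct_push (home_injective i)]
    norm_cast
    simp only [mul_ite, mul_zero, ite_mul, zero_mul]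
    rw [Finset.sum_congr rfl fun k _ => show _ = if k ∈ P then 1 / √(P.card : ℝ) * (1 / √P.card)
      else 0 by split_ifs <;> rfl, Finset.sum_ite_mem, Finset.univ_inter, Finset.sum_const,
      nsmul_eq_mul, div_mul_div_comm, Real.mul_self_sqrt hc.le]
    field_simp
  have h2 : star (uniform i P (1 / √P.card)) ⬝ᵥ Pi.single (start i) 1 = 0 := by
    rw [dotProduct_single_one, Pi.star_apply, h0, star_zero]
  have h3 : star (Pi.single (start i) (1 : ℂ)) ⬝ᵥ uniform i P (1 / √P.card) = 0 := by
    rw [← Pi.single_star, star_one, single_one_dotProduct, h0]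
  have h4 : star (Pi.single (start i) (1 : ℂ)) ⬝ᵥ Pi.single (start i) 1 = 1 := by
    simp
  rw [reflection_mulVec]
  simp only [star_add, add_dotProduct, dotProduct_add, h1, h2, h3, h4]
  norm_num

/-- Six queries make one iteration. The first three fetch the end point, the label and the variable
at the end point; the last two of these are added in the same register. The sign is then set by
`mark`, and the other three queries erase the variable, the label and the end point, so that the
state returns to the span of `home i` before it is reflected. -/
theorem finalState_unitaries (hP : P.Nonempty) (j : ℕ) :
    finalState o (start i) (unitaries i P mark) (6 * j) =
      push (home i) (amplitudes o i P mark j) := by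
  induction j with
  | zero => exact reflection_start i P hP
  | succ j ih =>
    have e : ∀ r < 6, (6 * j + r) % 6 = r := fun r hr => by omega
    have e0 := e 0 (by norm_num)
    have e1 := e 1 (by norm_num)
    have e2 := e 2 (by norm_num)
    have e3 := e 3 (by norm_num)
    have e4 := e 4 (by norm_num)
    have e5 := e 5 (by norm_num)
    rw [add_zero] at e0
    -- Erasure of the variable `b` from the negated sum leaves the negated label.
    have hz : ∀ a b : Answer n, -(a + b) + b = -a := fun a b => by abel
    have hh : home i = fun k => state (.target i k) 0 k 0 := rfl
    rw [show 6 * (j + 1) = 6 * j + 1 + 1 + 1 + 1 + 1 + 1 by ring]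
    simp only [finalState, ih, unitaries, e0, e1, e2, e3, e4, e5]
    rw [hh]
    simp only [applyQuery_state, signedPerm_mulVec_push, exchange_target, exchange_label,
      redirect_label, redirect_var, negate_state, zero_add, Equiv.trans_apply,
      Bool.false_eq_true, if_false, stored_state, hz, neg_add_cancel]
    rw [← hh]
    exact reflection_uniform i P _

end Grover

/-! ### The rotation in the plane of marked and unmarked positions. -/

namespace Grover

theorem rotate_sin {p q N φ : ℝ} (hp : 0 < p) (hN : 0 < N) (h : p ^ 2 + q ^ 2 = N) {θ : ℝ}
    (hs : Real.sin θ = p / √N) (hc : Real.cos θ = q / √N) :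
    2 * (q * Real.cos φ - p * Real.sin φ) / N + Real.sin φ / p = Real.sin (φ + 2 * θ) / p := by
  have hN' : √N * √N = N := Real.mul_self_sqrt hN.le
  have hne : √N ≠ 0 := (Real.sqrt_pos.2 hN).ne'
  have h1 : Real.sin (2 * θ) = 2 * p * q / N := by
    rw [Real.sin_two_mul, hs, hc,
      show 2 * (p / √N) * (q / √N) = 2 * p * q / (√N * √N) by field_simp, hN']
  have h2 : Real.cos (2 * θ) = (q ^ 2 - p ^ 2) / N := by
    rw [Real.cos_two_mul', hs, hc, div_pow, div_pow, pow_two √N, hN']; ring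
  rw [Real.sin_add, h1, h2]
  field_simp
  rw [← h]
  ring

theorem rotate_cos {p q N φ : ℝ} (hq : 0 < q) (hN : 0 < N) (h : p ^ 2 + q ^ 2 = N) {θ : ℝ}
    (hs : Real.sin θ = p / √N) (hc : Real.cos θ = q / √N) :
    2 * (q * Real.cos φ - p * Real.sin φ) / N - Real.cos φ / q = Real.cos (φ + 2 * θ) / q := by
  have hN' : √N * √N = N := Real.mul_self_sqrt hN.le
  have hne : √N ≠ 0 := (Real.sqrt_pos.2 hN).ne'
  have h1 : Real.sin (2 * θ) = 2 * p * q / N := by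
    rw [Real.sin_two_mul, hs, hc,
      show 2 * (p / √N) * (q / √N) = 2 * p * q / (√N * √N) by field_simp, hN']
  have h2 : Real.cos (2 * θ) = (q ^ 2 - p ^ 2) / N := by
    rw [Real.cos_two_mul', hs, hc, div_pow, div_pow, pow_two √N, hN']; ring
  rw [Real.cos_add, h1, h2]
  field_simp
  rw [← h]
  ring

variable {n : ℕ} (o : Query n → Answer n) (i : Fin n) (P : Finset (Fin n))
  (mark : Fin n → Answer n → Bool)

/-- The state always lies in the plane spanned by the uniform superpositions of marked and of
unmarked positions, and its angle grows from `θ` by `2 * θ` per iteration; `rotate_sin` and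
`rotate_cos` are the two coordinates of this rotation. If all of `P` is marked, the branch that
divides by zero does not occur. -/
theorem amplitudes_eq {θ : ℝ} (hM : ∃ k ∈ P, Marked o i mark k)
    (hs : Real.sin θ = √(P.filter (Marked o i mark)).card / √P.card)
    (hc : Real.cos θ = √(P.filter fun k => ¬ Marked o i mark k).card / √P.card) (j : ℕ)
    (k : Fin n) :
    amplitudes o i P mark j k =
      if k ∈ P then
        if Marked o i mark k then Real.sin ((2 * j + 1) * θ) / √(P.filter (Marked o i mark)).card
        else Real.cos ((2 * j + 1) * θ) / √(P.filter fun k => ¬ Marked o i mark k).card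
      else 0 := by
  obtain ⟨k₀, hk₀, hm₀⟩ := hM
  have hN : (0 : ℝ) < P.card := by exact_mod_cast Finset.card_pos.2 ⟨k₀, hk₀⟩
  have hp : 0 < √((P.filter (Marked o i mark)).card : ℝ) := Real.sqrt_pos.2 <| by
    exact_mod_cast Finset.card_pos.2 ⟨k₀, by simp [hk₀, hm₀]⟩
  have hq : k ∈ P → ¬ Marked o i mark k →
      0 < √((P.filter fun k => ¬ Marked o i mark k).card : ℝ) := fun hk hm => Real.sqrt_pos.2 <| by
    exact_mod_cast Finset.card_pos.2 ⟨k, by simp [hk, hm]⟩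
  have h : √((P.filter (Marked o i mark)).card : ℝ) ^ 2 +
      √((P.filter fun k => ¬ Marked o i mark k).card : ℝ) ^ 2 = P.card := by
    rw [Real.sq_sqrt (by positivity), Real.sq_sqrt (by positivity)]
    exact_mod_cast Finset.card_filter_add_card_filter_not (s := P) (Marked o i mark)
  induction j generalizing k with
  | zero =>
    simp only [amplitudes, CharP.cast_eq_zero, mul_zero, zero_add, one_mul, hs, hc]
    split_ifs with h1 h2
    · field_simp
    · have := hq h1 h2
      field_simp
    · rfl
  | succ j ih =>
    have hsum : (∑ k ∈ P, if Marked o i mark k then -amplitudes o i P mark j k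
        else amplitudes o i P mark j k) =
        √((P.filter fun k => ¬ Marked o i mark k).card : ℝ) * Real.cos ((2 * j + 1) * θ) -
        √((P.filter (Marked o i mark)).card : ℝ) * Real.sin ((2 * j + 1) * θ) := by
      -- This holds for `a = 0` too, which covers the case without unmarked positions.
      have hdiv : ∀ a b : ℝ, 0 ≤ a → a * (b / √a) = √a * b := fun a b ha => by
        rcases ha.eq_or_lt with rfl | ha
        · simp
        · have := Real.sqrt_pos.2 ha
          field_simp
          rw [Real.sq_sqrt ha.le, mul_comm]
      have hA : ∀ k ∈ P.filter (Marked o i mark), -amplitudes o i P mark j k =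
          -(Real.sin ((2 * j + 1) * θ) / √((P.filter (Marked o i mark)).card : ℝ)) := fun k hk => by
        rw [Finset.mem_filter] at hk
        rw [ih k fun _ hm => absurd hk.2 hm, if_pos hk.1, if_pos hk.2]
      have hB : ∀ k ∈ P.filter fun k => ¬ Marked o i mark k, amplitudes o i P mark j k =
          Real.cos ((2 * j + 1) * θ) / √((P.filter fun k => ¬ Marked o i mark k).card : ℝ) :=
        fun k hk => by
          have hpos := Real.sqrt_pos.2 (Nat.cast_pos.2 (Finset.card_pos.2 ⟨k, hk⟩) :
            (0 : ℝ) < (P.filter fun k => ¬ Marked o i mark k).card)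
          rw [Finset.mem_filter] at hk
          rw [ih k fun _ _ => hpos, if_pos hk.1, if_neg hk.2]
      rw [Finset.sum_ite, Finset.sum_congr rfl hA, Finset.sum_congr rfl hB]
      rw [Finset.sum_const, Finset.sum_const, nsmul_eq_mul, nsmul_eq_mul, mul_neg,
        hdiv _ _ (by positivity), hdiv _ _ (by positivity)]
      ring
    have hang : (2 * ((j + 1 : ℕ) : ℝ) + 1) * θ = (2 * j + 1) * θ + 2 * θ := by push_cast; ring
    rw [amplitudes, iterate, hsum, ih k hq, hang]
    split_ifs with h1 h2
    · rw [sub_neg_eq_add, rotate_sin hp hN h hs hc]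
    · rw [rotate_cos (hq h1 h2) hN h hs hc]
    · simp
    · simp

theorem outcomes_push {I A : Type} [Fintype I] [DecidableEq I] [Fintype A] [DecidableEq A]
    [AddCommGroup A] {K : Type} [Fintype K] [DecidableEq K] {x : I → A} {w : ℕ}
    {init : Basis I A w} {U : ℕ → Matrix.unitaryGroup (Basis I A w) ℂ} {T : ℕ}
    {g : K → Basis I A w} {α : K → ℝ} (hg : Function.Injective g)
    (h : finalState x init U T = push g α) (S : Set (Basis I A w)) [DecidablePred (· ∈ S)] :
    (outcomes x init U T).toOuterMeasure S =
      ENNReal.ofReal (∑ k, if g k ∈ S then α k ^ 2 else 0) := by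
  rw [PMF.toOuterMeasure_apply, tsum_fintype, ENNReal.ofReal_sum_of_nonneg
    (fun k _ => by positivity)]
  refine (Fintype.sum_of_injective g hg _ _ ?_ ?_).symm
  · intro b hb
    simp [outcomes, h, push_apply_of_notMem _ hb, Set.indicator_apply]
  · intro k
    simp only [outcomes, PMF.ofFintype_apply, h, push_apply hg, Set.indicator_apply]
    split_ifs <;> simp

/-- Grover's algorithm with `j` iterations; the result is the measured position. -/
noncomputable def measure (j : ℕ) : CProg n (Fin n) :=
  .quantum (n * (n + 2)) (6 * j) (start i) (unitaries i P mark) fun b => .ret (position b)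

theorem errProb_measure_le {θ : ℝ} (hM : ∃ k ∈ P, Marked o i mark k)
    (hs : Real.sin θ = √(P.filter (Marked o i mark)).card / √P.card)
    (hc : Real.cos θ = √(P.filter fun k => ¬ Marked o i mark k).card / √P.card) (j : ℕ) :
    (measure i P mark j).errProb o {k | k ∈ P ∧ Marked o i mark k} ≤
      ENNReal.ofReal (Real.cos ((2 * j + 1) * θ) ^ 2) := by
  classical
  have hP : P.Nonempty := ⟨_, hM.choose_spec.1⟩
  simp only [Prog.errProb, measure, Prog.run, PMF.pure_map]
  rw [show (outcomes o (start i) (unitaries i P mark) (6 * j)).bind (fun b => PMF.pure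
      ((position b, 0 + 6 * j) : Fin n × ℕ)) = (outcomes o (start i) (unitaries i P mark)
        (6 * j)).map fun b => (position b, 0 + 6 * j) from rfl, PMF.toOuterMeasure_map_apply,
    outcomes_push (home_injective i) (finalState_unitaries o i P mark hP j)]
  refine ENNReal.ofReal_le_ofReal ?_
  have hterm : ∀ k, (if home i k ∈ ((fun b => (position b, 0 + 6 * j)) ⁻¹'
      {ω : Fin n × ℕ | ω.1 ∉ {k | k ∈ P ∧ Marked o i mark k}}) then
        amplitudes o i P mark j k ^ 2 else 0) =
      if k ∈ P.filter fun k => ¬ Marked o i mark k then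
        (Real.cos ((2 * j + 1) * θ) / √(P.filter fun k => ¬ Marked o i mark k).card) ^ 2
      else 0 := fun k => by
    rw [amplitudes_eq o i P mark hM hs hc j k]
    simp only [Set.mem_preimage, Set.mem_ofPred_eq, home, position_state, Finset.mem_filter]
    by_cases h1 : k ∈ P <;> by_cases h2 : Marked o i mark k <;> simp [h1, h2]
  rw [Finset.sum_congr rfl fun k _ => hterm k, Finset.sum_ite_mem, Finset.univ_inter,
    Finset.sum_const, nsmul_eq_mul, div_pow, Real.sq_sqrt (by positivity), mul_div_assoc']
  -- Without unmarked positions the failure probability is zero; otherwise the number of unmarked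
  -- positions cancels.
  rcases Nat.eq_zero_or_pos (P.filter fun k => ¬ Marked o i mark k).card with h | h
  · rw [h]; simp; positivity
  · have : (0 : ℝ) < (P.filter fun k => ¬ Marked o i mark k).card := by exact_mod_cast h
    rw [mul_div_cancel_left₀ _ this.ne']

end Grover

/-! ### Search with an unknown number of marked positions. -/

namespace Grover

/-- Take the first `ℓ` with `3 ^ ℓ * θ ≥ π / 6`. Tripling an angle below `π / 6` cannot pass `π /
2`, so the sine at this `ℓ` is at least `1 / 2`. Such an `ℓ` occurs by `Nat.clog 9 N`, because `3 ^
Nat.clog 9 N ≥ √N` and `θ ≥ sin θ ≥ 1 / √N`. -/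
theorem exists_cos_sq_le {θ : ℝ} {N : ℕ} (hN : 0 < N) (hs : 1 / √N ≤ Real.sin θ)
    (h0 : 0 ≤ θ) (h1 : θ ≤ Real.pi / 2) :
    ∃ ℓ < Nat.clog 9 N + 1, Real.cos (3 ^ ℓ * θ) ^ 2 ≤ 3 / 4 := by
  have hN' : (0 : ℝ) < √N := Real.sqrt_pos.2 (by exact_mod_cast hN)
  have hL : Real.pi / 6 ≤ 3 ^ Nat.clog 9 N * θ := by
    have h9 : √(N : ℝ) ≤ 3 ^ Nat.clog 9 N := by
      refine Real.sqrt_le_iff.2 ⟨by positivity, ?_⟩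
      rw [← pow_mul, mul_comm, pow_mul]
      exact_mod_cast Nat.le_pow_clog (by norm_num) N
    have h2 : 1 ≤ √(N : ℝ) * θ := by
      have := hs.trans (Real.sin_le h0)
      rwa [div_le_iff₀' hN'] at this
    have := Real.pi_le_four
    nlinarith [mul_le_mul_of_nonneg_right h9 h0]
  classical
  have hex : ∃ ℓ, Real.pi / 6 ≤ 3 ^ ℓ * θ := ⟨_, hL⟩
  refine ⟨Nat.find hex, Nat.lt_succ_of_le (Nat.find_min' hex hL), ?_⟩
  have hlow := Nat.find_spec hex
  have hupp : 3 ^ Nat.find hex * θ ≤ Real.pi / 2 := by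
    rcases h : Nat.find hex with _ | m
    · simpa using h1
    · have := Nat.find_min hex (m := m) (by omega)
      rw [pow_succ]
      linarith
  have hsin := Real.sin_le_sin_of_le_of_le_pi_div_two (by linarith [Real.pi_pos]) hupp hlow
  rw [Real.sin_pi_div_six] at hsin
  nlinarith [Real.sin_sq_add_cos_sq (3 ^ Nat.find hex * θ)]

variable {n : ℕ} (o : Query n → Answer n) (i : Fin n) (P : Finset (Fin n))
  (mark : Fin n → Answer n → Bool)

/-- Grover's algorithm with `(3 ^ ℓ - 1) / 2` iterations and a test of the measured position. -/
noncomputable def attempt (ℓ : ℕ) : CProg n (Option (Fin n)) :=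
  (measure i P mark ((3 ^ ℓ - 1) / 2)).bind fun k =>
    (Prog.query (.target i k)).bind fun a => (Prog.query (.label i k)).bind fun b =>
      (Prog.query (.var (toVertex i a))).bind fun c =>
        .ret (if k ∈ P ∧ mark (toVertex i a) (b + c) = true then some k else none)

theorem two_mul_half_pow (ℓ : ℕ) : 2 * ((3 ^ ℓ - 1) / 2) + 1 = 3 ^ ℓ := by
  have : Odd (3 ^ ℓ) := Odd.pow (by decide)
  obtain ⟨m, hm⟩ := this
  omega

theorem ensures_attempt (ℓ : ℕ) : (attempt i P mark ℓ).Ensures o fun r q =>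
    (q : ℝ) ≤ 3 ^ (ℓ + 1) ∧ ∀ k ∈ r, k ∈ P ∧ Marked o i mark k := by
  refine Prog.Ensures.bind (Q := fun _ q => q = 6 * ((3 ^ ℓ - 1) / 2)) ?_ ?_
  · intro ω hω
    simp only [measure, Prog.run, PMF.pure_map, PMF.mem_support_bind_iff, PMF.support_pure,
      Set.mem_singleton_iff] at hω
    obtain ⟨b, -, rfl⟩ := hω
    simp
  · rintro k q rfl
    refine Prog.ensures_query_bind <| Prog.ensures_query_bind <| Prog.ensures_query_bind <|
      Prog.ensures_ret ⟨?_, ?_⟩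
    · have := two_mul_half_pow ℓ
      rw [pow_succ]
      exact_mod_cast (by omega :
        6 * ((3 ^ ℓ - 1) / 2) + (1 + (1 + (1 + 0))) ≤ 3 ^ ℓ * 3)
    · intro k' hk'
      simp only [Option.mem_def, Option.ite_none_right_eq_some, Option.some.injEq] at hk'
      obtain ⟨h, rfl⟩ := hk'
      exact h

theorem errProb_attempt_le (ℓ : ℕ) : (attempt i P mark ℓ).errProb o {none}ᶜ ≤
    (measure i P mark ((3 ^ ℓ - 1) / 2)).errProb o {k | k ∈ P ∧ Marked o i mark k} := by
  refine (Prog.errProb_bind_le_add (Q := fun _ _ => True) (fun _ _ => trivial) (ε := 0) ?_).trans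
    (add_zero _).le
  rintro k q - ⟨hk, hm⟩
  refine Prog.errProb_query_bind.trans <| Prog.errProb_query_bind.trans <|
    Prog.errProb_query_bind.trans (Prog.errProb_ret ?_).le
  simp only [Set.mem_compl_iff, Set.mem_singleton_iff]
  rw [if_pos ⟨hk, hm⟩]
  simp

/-- An empty set gets no stage at all, since its cost bound `27 * √0` is zero. -/
def numStages (N : ℕ) : ℕ := if N = 0 then 0 else Nat.clog 9 N + 1

/-- Attempts with all relevant numbers of iterations. -/
noncomputable def sweep : CProg n (Option (Fin n)) :=
  Prog.firstSome (attempt i P mark) (List.range (numStages P.card))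

theorem ensures_sweep : (sweep i P mark).Ensures o fun r q =>
    (q : ℝ) ≤ 27 * √P.card ∧ ∀ k ∈ r, k ∈ P ∧ Marked o i mark k := by
  refine (Prog.ensures_firstSome (c := fun ℓ => 3 ^ (ℓ + 1))
    (P := fun k => k ∈ P ∧ Marked o i mark k) _ (fun ℓ => by positivity)
    (fun ℓ _ => ensures_attempt o i P mark ℓ)).mono ?_
  rintro r q ⟨hq, hr⟩
  refine ⟨hq.trans ?_, hr⟩
  have hgeom : ∀ m : ℕ, ((List.range m).map fun ℓ => (3 : ℝ) ^ (ℓ + 1)).sum ≤ 3 ^ (m + 1) - 3 := by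
    intro m
    induction m with
    | zero => simp
    | succ m ih =>
      rw [List.range_succ, List.map_append, List.sum_append]
      simp only [List.map_cons, List.map_nil, List.sum_cons, List.sum_nil, add_zero]
      have : (0 : ℝ) < 3 ^ m := by positivity
      rw [pow_succ 3 (m + 1), pow_succ] at *
      linarith
  refine (hgeom _).trans ?_
  rw [numStages]
  split_ifs with h
  · simp [h]
  · have hpos : 0 < P.card := Nat.pos_of_ne_zero h
    have h1 : (1 : ℝ) ≤ √P.card := Real.one_le_sqrt.2 (by exact_mod_cast hpos)
    rcases hc : Nat.clog 9 P.card with _ | m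
    · norm_num
      linarith
    · have h2 : (9 : ℝ) ^ m < P.card := by
        have := (Nat.lt_clog_iff_pow_lt (b := 9) (by norm_num) (x := P.card) (y := m)).1 (by omega)
        exact_mod_cast this
      have h3 : (3 : ℝ) ^ m ≤ √P.card := by
        refine Real.le_sqrt_of_sq_le ?_
        rw [← pow_mul, mul_comm, pow_mul]
        norm_num
        exact h2.le
      rw [pow_succ, pow_succ, pow_succ]
      linarith

theorem errProb_sweep_le (h : ∃ k ∈ P, Marked o i mark k) :
    (sweep i P mark).errProb o {none}ᶜ ≤ ENNReal.ofReal (3 / 4) := by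
  refine (Prog.errProb_firstSome_le _).trans ?_
  obtain ⟨k₀, hk₀, hm₀⟩ := h
  have hP : 0 < P.card := Finset.card_pos.2 ⟨k₀, hk₀⟩
  have hN : (0 : ℝ) < P.card := by exact_mod_cast hP
  have hN' := Real.sqrt_pos.2 hN
  have hcard : ((P.filter (Marked o i mark)).card : ℝ) +
      (P.filter fun k => ¬ Marked o i mark k).card = P.card := by
    exact_mod_cast Finset.card_filter_add_card_filter_not (s := P) (Marked o i mark)
  set t : ℝ := ((P.filter (Marked o i mark)).card : ℝ) with ht
  set u : ℝ := ((P.filter fun k => ¬ Marked o i mark k).card : ℝ) with hu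
  have ht1 : 1 ≤ t := by
    have : 0 < (P.filter (Marked o i mark)).card := Finset.card_pos.2 ⟨k₀, by simp [hk₀, hm₀]⟩
    rw [ht]
    exact_mod_cast this
  have hu0 : 0 ≤ u := by positivity
  have hs1 : √t / √P.card ≤ 1 := by
    rw [div_le_one hN']
    exact Real.sqrt_le_sqrt (by linarith)
  have hs0 : 0 ≤ √t / √P.card := by positivity
  have hs : Real.sin (Real.arcsin (√t / √P.card)) = √t / √P.card :=
    Real.sin_arcsin (by linarith) hs1
  have hc : Real.cos (Real.arcsin (√t / √P.card)) = √u / √P.card := by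
    rw [Real.cos_arcsin, ← Real.sqrt_div hu0, div_pow, Real.sq_sqrt (by linarith),
      Real.sq_sqrt hN.le]
    congr 1
    field_simp
    linarith
  obtain ⟨ℓ, hℓ, hcos⟩ := exists_cos_sq_le (θ := Real.arcsin (√t / √P.card)) hP (by
    rw [hs]
    exact div_le_div_of_nonneg_right (Real.one_le_sqrt.2 ht1) hN'.le)
    (Real.arcsin_nonneg.2 hs0) (Real.arcsin_le_pi_div_two _)
  have hle : (attempt i P mark ℓ).errProb o {none}ᶜ ≤ ENNReal.ofReal (3 / 4) := by
    refine (errProb_attempt_le o i P mark ℓ).trans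
      ((errProb_measure_le o i P mark ⟨k₀, hk₀, hm₀⟩ hs hc _).trans (ENNReal.ofReal_le_ofReal ?_))
    have h3 : 2 * (((3 ^ ℓ - 1) / 2 : ℕ) : ℝ) + 1 = 3 ^ ℓ := by
      exact_mod_cast two_mul_half_pow ℓ
    rwa [h3]
  have hmem : ℓ ∈ List.range (numStages P.card) := by
    rw [numStages, if_neg hP.ne']
    exact List.mem_range.2 hℓ
  -- The good stage contributes a factor at most `3 / 4` to the product, every other stage a factor
  -- at most `1`.
  generalize List.range (numStages P.card) = l at hmem
  induction l with
  | nil => simp at hmem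
  | cons a l ih =>
    have hprod : (l.map fun ℓ => (attempt i P mark ℓ).errProb o {none}ᶜ).prod ≤ 1 := by
      clear hmem ih
      induction l with
      | nil => simp
      | cons b l ih =>
        rw [List.map_cons, List.prod_cons]
        exact (mul_le_mul' (Prog.errProb_le_one _ _) ih).trans (mul_one _).le
    rw [List.map_cons, List.prod_cons]
    rcases List.mem_cons.1 hmem with rfl | hmem
    · exact (mul_le_mul' hle hprod).trans (mul_one _).le
    · exact (mul_le_mul' (Prog.errProb_le_one _ _) (ih hmem)).trans (one_mul _).le

/-- The search with error probability at most `2 ^ (-r)`. -/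
noncomputable def find (r : ℕ) : CProg n (Option (Fin n)) :=
  Prog.firstSome (fun _ => sweep i P mark) (List.range (3 * r))

theorem ensures_find (r : ℕ) : (find i P mark r).Ensures o fun z q =>
    (q : ℝ) ≤ 81 * r * √P.card ∧ ∀ k ∈ z, k ∈ P ∧ Marked o i mark k := by
  refine (Prog.ensures_firstSome (c := fun _ => 27 * √P.card) _ (fun ℓ => by positivity)
    (fun ℓ _ => ensures_sweep o i P mark)).mono ?_
  rintro z q ⟨hq, hz⟩
  refine ⟨hq.trans (le_of_eq ?_), hz⟩
  simp
  ring

/-- Three sweeps halve the error, since `(3 / 4) ^ 3 = 27 / 64 ≤ 1 / 2`; they cost `3 * 27 = 81`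
times the square root. -/
theorem errProb_find_le (r : ℕ) (h : ∃ k ∈ P, Marked o i mark k) :
    (find i P mark r).errProb o {none}ᶜ ≤ (1 / 2) ^ r := by
  refine (Prog.errProb_firstSome_le _).trans ?_
  rw [List.map_const', List.prod_replicate, List.length_range, pow_mul]
  refine pow_le_pow_left' ((pow_le_pow_left' (errProb_sweep_le o i P mark h) 3).trans ?_) r
  rw [← ENNReal.ofReal_pow (by norm_num), show (1 / 2 : ℝ≥0∞) = ENNReal.ofReal (1 / 2) by
    rw [ENNReal.ofReal_div_of_pos (by norm_num)]; simp]
  exact ENNReal.ofReal_le_ofReal (by norm_num)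

end Grover

end QQuery

open scoped ENNReal
open QQuery

/-! # Search for the first element -/

namespace FirstSearch

variable {n : ℕ}

/-- Binary search for the first element in the `2 ^ k` positions from `lo` on, where `z` is a known
element and `S r lo hi` searches in the positions from `lo` to `hi - 1`, with an error probability
that decreases with `r`. -/
def narrow (S : ℕ → ℕ → ℕ → CProg n (Option (Fin n))) : ℕ → ℕ → ℕ → Fin n → CProg n (Fin n)
  | 0, _, _, z => .ret z
  | k + 1, r, lo, z => (S (r + 1) lo (lo + 2 ^ k)).bind fun z' =>
      match z' with
      | none => narrow S k (r + 1) (lo + 2 ^ k) z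
      | some z' => narrow S k (r + 1) lo z'

/-- Search in intervals of increasing lengths `2 ^ k`, from `lo` to `d - 1`. -/
def window (S : ℕ → ℕ → ℕ → CProg n (Option (Fin n))) (r d : ℕ) :
    ℕ → ℕ → ℕ → CProg n (Option (Fin n))
  | 0, _, _ => .ret none
  | fuel + 1, k, lo =>
      if d ≤ lo then .ret none
      else (S r lo (lo + 2 ^ k)).bind fun z =>
        match z with
        | none => window S r d fuel (k + 1) (lo + 2 ^ k)
        | some z => (narrow S k r lo z).bind fun z' => .ret (some z')

variable {o : Query n → Answer n} {S : ℕ → ℕ → ℕ → CProg n (Option (Fin n))} {F : Fin n → Prop}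

theorem sqrt_two_mul_le (k : ℕ) : 1.41 * √(2 ^ k : ℝ) ≤ √(2 ^ (k + 1) : ℝ) := by
  rw [pow_succ, mul_comm ((2 : ℝ) ^ k), Real.sqrt_mul (by norm_num)]
  refine mul_le_mul_of_nonneg_right (Real.le_sqrt_of_sq_le (by norm_num)) (Real.sqrt_nonneg _)

/-- The costs decrease geometrically with ratio about `1 / √2` although `r` grows. The factor `3 * r
+ 10` is chosen such that the recursion closes: `(r + 1) + (3 * (r + 1) + 10) = 4 * r + 14 ≤ 1.41 *
(3 * r + 10)`. -/
theorem ensures_narrow (hS : ∀ r lo k, (S r lo (lo + 2 ^ k)).Ensures o fun z q =>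
      (q : ℝ) ≤ 81 * r * √(2 ^ k : ℝ) ∧ ∀ k' ∈ z, lo ≤ k'.val ∧ k'.val < lo + 2 ^ k ∧ F k')
    {L : ℕ} (k r lo : ℕ) (z : Fin n) (hL : L ≤ lo) (hz : L ≤ z.val) (hF : F z) :
    (narrow S k r lo z).Ensures o fun z q =>
      (q : ℝ) ≤ 81 * (3 * r + 10) * √(2 ^ k : ℝ) ∧ L ≤ z.val ∧ F z := by
  induction k generalizing r lo z with
  | zero =>
    refine Prog.ensures_ret ⟨?_, hz, hF⟩
    push_cast
    positivity
  | succ k ih =>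
    have hcost : ∀ q q' : ℕ, (q : ℝ) ≤ 81 * (r + 1 : ℕ) * √(2 ^ k : ℝ) →
        (q' : ℝ) ≤ 81 * (3 * (r + 1 : ℕ) + 10) * √(2 ^ k : ℝ) →
        ((q + q' : ℕ) : ℝ) ≤ 81 * (3 * r + 10) * √(2 ^ (k + 1) : ℝ) := by
      intro q q' hq hq'
      have h1 := sqrt_two_mul_le k
      have h2 := Real.sqrt_nonneg (2 ^ k : ℝ)
      have h3 : (81 * (3 * r + 10) : ℝ) * (1.41 * √(2 ^ k : ℝ)) ≤
          81 * (3 * r + 10) * √(2 ^ (k + 1) : ℝ) :=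
        mul_le_mul_of_nonneg_left h1 (by positivity)
      push_cast at *
      nlinarith [mul_nonneg (Nat.cast_nonneg (α := ℝ) r) h2]
    refine (hS (r + 1) lo k).bind ?_
    rintro (_ | z') q ⟨hq, hz'⟩
    · exact (ih (r + 1) (lo + 2 ^ k) z (hL.trans (Nat.le_add_right _ _)) hz hF).mono
        fun a q' h => ⟨hcost q q' hq h.1, h.2⟩
    · obtain ⟨h1, h2, h3⟩ := hz' z' rfl
      exact (ih (r + 1) lo z' hL (hL.trans h1) h3).mono fun a q' h => ⟨hcost q q' hq h.1, h.2⟩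

theorem half_pow_add (r : ℕ) : (1 / 2 : ℝ≥0∞) ^ (r + 1) + (1 / 2) ^ (r + 1) = (1 / 2) ^ r := by
  rw [pow_succ, ← mul_add, ENNReal.add_halves, mul_one]

/-- If the first element `f` is in the left half, the search there fails with probability at most `2
^ (-(r + 1))`. If it is in the right half, the left half is empty and the search surely finds
nothing; the known element `z` is then in the right half because it is not before `f`. The remaining
half of the error budget goes to the recursion. -/
theorem errProb_narrow_le (hS : ∀ r lo k, (S r lo (lo + 2 ^ k)).Ensures o fun z q =>
      (q : ℝ) ≤ 81 * r * √(2 ^ k : ℝ) ∧ ∀ k' ∈ z, lo ≤ k'.val ∧ k'.val < lo + 2 ^ k ∧ F k')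
    (hS' : ∀ r lo k, (∃ k' : Fin n, lo ≤ k'.val ∧ k'.val < lo + 2 ^ k ∧ F k') →
      (S r lo (lo + 2 ^ k)).errProb o {none}ᶜ ≤ (1 / 2) ^ r)
    {f : Fin n} (hf : F f) {L : ℕ} (hmin : ∀ k' : Fin n, L ≤ k'.val → F k' → f ≤ k')
    (k r lo : ℕ) (z : Fin n) (hL : L ≤ lo) (hlo : lo ≤ f.val) (hhi : f.val < lo + 2 ^ k)
    (hz : lo ≤ z.val) (hzk : z.val < lo + 2 ^ k) (hF : F z) :
    (narrow S k r lo z).errProb o {f} ≤ (1 / 2) ^ r := by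
  induction k generalizing r lo z with
  | zero =>
    have : z = f := Fin.ext (by simp at hhi hzk; omega)
    exact (Prog.errProb_ret (by simpa using this)).trans_le zero_le
  | succ k ih =>
    rw [← half_pow_add]
    by_cases hfk : f.val < lo + 2 ^ k
    · refine (Prog.errProb_bind_le_add (S := {none}ᶜ) (hS (r + 1) lo k)
        (ε := (1 / 2) ^ (r + 1)) ?_).trans (add_le_add_left (hS' _ _ _ ⟨f, hlo, hfk, hf⟩) _)
      rintro (_ | z') q ⟨-, hz'⟩ hne
      · simp at hne
      · obtain ⟨h1, h2, h3⟩ := hz' z' rfl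
        exact ih (r + 1) lo z' hL hlo hfk h1 h2 h3
    · refine (Prog.errProb_bind_le_add (S := {none}) (hS (r + 1) lo k)
        (ε := (1 / 2) ^ (r + 1)) ?_).trans (add_le_add_left (le_of_eq_of_le
          (Prog.errProb_eq_zero ((hS (r + 1) lo k).mono ?_)) zero_le) _)
      · rintro (_ | z') q ⟨-, hz'⟩ hne
        · have h := hmin z (hL.trans hz) hF
          rw [Fin.le_def] at h
          exact ih (r + 1) (lo + 2 ^ k) z (hL.trans (Nat.le_add_right _ _)) (by omega)
            (by rw [pow_succ] at hhi; omega) (by omega) (by rw [pow_succ] at hzk; omega) hF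
        · simp at hne
      · rintro (_ | z') q ⟨-, hz'⟩
        · simp
        · obtain ⟨h1, h2, h3⟩ := hz' z' rfl
          have h := hmin z' (hL.trans h1) h3
          rw [Fin.le_def] at h
          omega

/-- The number of positions passed by a search from `start` to the given result, or to `d`. -/
noncomputable def distance (d start : ℕ) : Option (Fin n) → ℝ
  | none => (d : ℝ) - start
  | some z => (z.val : ℝ) + 1 - start

/-- The windows before `lo` have lengths `1, 2, …, 2 ^ (k - 1)`, whence the invariant `hlo`. The
term `-3 * √(2 ^ k)` makes the induction close: an empty window needs `√(2 ^ k) + 3 * √(2 ^ k) ≤ 3 *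
√(2 ^ (k + 1))`, which holds as `4 ≤ 3 * 1.41`. The alternative `q = 0` covers an immediate stop,
where that bound may be negative. The bound refers to the reported result, so it holds for erroneous
runs too. -/
theorem ensures_window (hS : ∀ r lo k, (S r lo (lo + 2 ^ k)).Ensures o fun z q =>
      (q : ℝ) ≤ 81 * r * √(2 ^ k : ℝ) ∧ ∀ k' ∈ z, lo ≤ k'.val ∧ k'.val < lo + 2 ^ k ∧ F k')
    {r : ℕ} (hr : 1 ≤ r) (d start fuel k lo : ℕ) (hlo : lo + 1 = start + 2 ^ k) :
    (window S r d fuel k lo).Ensures o fun z q =>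
      (q = 0 ∨ (q : ℝ) ≤ 81 * r * (17 * √(distance d start z) - 3 * √(2 ^ k : ℝ))) ∧
        ∀ k' ∈ z, lo ≤ k'.val ∧ F k' := by
  induction fuel generalizing k lo with
  | zero => exact Prog.ensures_ret (by simp)
  | succ fuel ih =>
    rw [window]
    split_ifs with hd
    · exact Prog.ensures_ret (by simp)
    have hr' : (1 : ℝ) ≤ r := by exact_mod_cast hr
    have hs := Real.sqrt_nonneg (2 ^ k : ℝ)
    have hlo' : (lo : ℝ) + 1 = start + 2 ^ k := by exact_mod_cast hlo
    refine (hS r lo k).bind ?_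
    rintro (_ | z) q ⟨hq, hz⟩
    · refine (ih (k + 1) (lo + 2 ^ k) (by rw [pow_succ]; omega)).mono ?_
      rintro z q' ⟨hq', hz'⟩
      refine ⟨Or.inr ?_, fun k' hk' => ⟨(Nat.le_add_right _ _).trans (hz' k' hk').1,
        (hz' k' hk').2⟩⟩
      have hdist : √(2 ^ k : ℝ) ≤ √(distance d start z) := by
        refine Real.sqrt_le_sqrt ?_
        rcases z with _ | z
        · have : (lo : ℝ) + 1 ≤ d := by exact_mod_cast not_le.1 hd
          simp only [distance]
          linarith
        · have : ((lo + 2 ^ k : ℕ) : ℝ) ≤ z.val := by exact_mod_cast (hz' z rfl).1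
          simp only [distance]
          push_cast at this
          have : (0 : ℝ) < 2 ^ k := by positivity
          linarith
      have h2 := sqrt_two_mul_le k
      push_cast
      rcases hq' with rfl | hq'
      · have : 81 * r * √(2 ^ k : ℝ) ≤
            81 * r * (17 * √(distance d start z) - 3 * √(2 ^ k : ℝ)) :=
          mul_le_mul_of_nonneg_left (by linarith) (by positivity)
        push_cast
        linarith
      · have : 81 * r * (√(2 ^ k : ℝ) + (17 * √(distance d start z) - 3 * √(2 ^ (k + 1) : ℝ))) ≤
            81 * r * (17 * √(distance d start z) - 3 * √(2 ^ k : ℝ)) :=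
          mul_le_mul_of_nonneg_left (by linarith) (by positivity)
        linarith
    · obtain ⟨h1, h2, h3⟩ := hz z rfl
      refine (ensures_narrow hS k r lo z le_rfl h1 h3).bind ?_
      rintro z' q' ⟨hq', hz', hF⟩
      refine Prog.ensures_ret ⟨Or.inr ?_, by simpa using ⟨hz', hF⟩⟩
      have hdist : √(2 ^ k : ℝ) ≤ √(distance d start (some z')) := by
        refine Real.sqrt_le_sqrt ?_
        have : (lo : ℝ) ≤ z'.val := by exact_mod_cast hz'
        simp only [distance]
        linarith
      -- Window search and `narrow` together cost `81 * (4 * r + 10) * √(2 ^ k)`, at most `81 * 14 *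
      -- r * √(2 ^ k)` for `r ≥ 1`; hence `17 = 14 + 3`.
      have h4 : 81 * r * (14 * √(2 ^ k : ℝ)) ≤
          81 * r * (17 * √(distance d start (some z')) - 3 * √(2 ^ k : ℝ)) :=
        mul_le_mul_of_nonneg_left (by linarith) (by positivity)
      push_cast
      nlinarith [mul_nonneg (sub_nonneg.2 hr') hs]

/-- Windows before `f` contain no element and surely report none. Errors arise only in the window of
`f`: one search and one call of `narrow`, each with half of the budget. -/
theorem errProb_window_le (hS : ∀ r lo k, (S r lo (lo + 2 ^ k)).Ensures o fun z q =>
      (q : ℝ) ≤ 81 * r * √(2 ^ k : ℝ) ∧ ∀ k' ∈ z, lo ≤ k'.val ∧ k'.val < lo + 2 ^ k ∧ F k')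
    (hS' : ∀ r lo k, (∃ k' : Fin n, lo ≤ k'.val ∧ k'.val < lo + 2 ^ k ∧ F k') →
      (S r lo (lo + 2 ^ k)).errProb o {none}ᶜ ≤ (1 / 2) ^ r)
    {f : Fin n} (hf : F f) {d : ℕ} (hd : f.val < d) (r fuel k lo : ℕ) (hlo : lo ≤ f.val)
    (hmin : ∀ k' : Fin n, lo ≤ k'.val → F k' → f ≤ k') (hfuel : d ≤ lo + fuel) :
    (window S (r + 1) d fuel k lo).errProb o {some f} ≤ (1 / 2) ^ r := by
  induction fuel generalizing k lo with
  | zero => omega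
  | succ fuel ih =>
    rw [window, if_neg (by omega)]
    by_cases hfk : f.val < lo + 2 ^ k
    · rw [← half_pow_add]
      refine (Prog.errProb_bind_le_add (S := {none}ᶜ) (hS (r + 1) lo k)
        (ε := (1 / 2) ^ (r + 1)) ?_).trans (add_le_add_left (hS' _ _ _ ⟨f, hlo, hfk, hf⟩) _)
      rintro (_ | z) q ⟨-, hz⟩ hne
      · simp at hne
      · obtain ⟨h1, h2, h3⟩ := hz z rfl
        refine (Prog.errProb_bind_singleton f).trans ?_
        rw [Prog.errProb_ret (by simp), add_zero]
        exact errProb_narrow_le hS hS' hf hmin k (r + 1) lo z le_rfl hlo hfk h1 h2 h3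
    · refine (Prog.errProb_bind_le_add (S := {none}) (hS (r + 1) lo k)
        (ε := (1 / 2) ^ r) ?_).trans ((add_le_add_left (le_of_eq_of_le
          (Prog.errProb_eq_zero ((hS (r + 1) lo k).mono ?_)) (le_refl 0)) _).trans (zero_add _).le)
      · rintro (_ | z) q - hne
        · have h2 := Nat.one_le_two_pow (n := k)
          exact ih (k + 1) (lo + 2 ^ k) (by omega) (fun k' hk' => hmin k' (by omega)) (by omega)
        · simp at hne
      · rintro (_ | z) q ⟨-, hz⟩
        · simp
        · obtain ⟨h1, h2, h3⟩ := hz z rfl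
          have h := hmin z h1 h3
          rw [Fin.le_def] at h
          omega

end FirstSearch

/-! # The subroutines -/

namespace Circuit

variable {n : ℕ} (G : Circuit n) (x : ℕ → Bool)

theorem oracle_target {i k j : Fin n} (h : (G.adj i)[k.val]? = some j) :
    (G.oracle x (.target i k)).val = j.val := by
  simp only [oracle, h, Option.map_some, Option.getD_some, Fin.val_ofNat]
  exact Nat.mod_eq_of_lt (by omega)

theorem toVertex_target {i k j : Fin n} (h : (G.adj i)[k.val]? = some j) :
    Grover.toVertex i (G.oracle x (.target i k)) = j := by
  have := G.oracle_target x h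
  ext
  simp [Grover.toVertex, this]

theorem oracle_label {i k j : Fin n} (h : (G.adj i)[k.val]? = some j) :
    (G.oracle x (.label i k)).val = (G.σ i j).toNat := by
  simp only [oracle, h, Option.map_some, Option.getD_some, Fin.val_ofNat]
  exact Nat.mod_eq_of_lt (by have := (G.σ i j).toNat_lt; omega)

theorem oracle_var (i : Fin n) :
    (G.oracle x (.var i)).val = if G.deg i = 0 then (x (G.var i)).toNat else 0 := by
  simp only [oracle, Fin.val_ofNat]
  exact Nat.mod_eq_of_lt (by split_ifs; · have := (x (G.var i)).toNat_lt; omega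
                             · omega)

end Circuit

/-! ### The two search predicates in terms of oracle answers. -/

namespace QQuery.Grover

variable {n : ℕ}

/-- The positions from `lo` to `hi - 1` in the list of `i`. -/
def positions (deg : Fin n → ℕ) (i : Fin n) (lo hi : ℕ) : Finset (Fin n) :=
  Finset.univ.filter fun k => lo ≤ k.val ∧ k.val < hi ∧ k.val < deg i

theorem card_positions_le (deg : Fin n → ℕ) (i : Fin n) (lo hi : ℕ) :
    (positions deg i lo hi).card ≤ hi - lo := by
  rw [← Nat.card_Ico lo hi]
  refine Finset.card_le_card_of_injOn Fin.val (fun k hk => ?_) Fin.val_injective.injOn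
  simp only [positions, Finset.coe_filter, Finset.mem_univ, true_and, Set.mem_ofPred_eq] at hk
  simp [hk.1, hk.2.1]

/-- The vertex is a non-visited non-sink. -/
def freshMark (deg : Fin n → ℕ) (visited : Fin n → Bool) (j : Fin n) (_ : Answer n) : Bool :=
  !visited j && decide (0 < deg j)

/-- The argument with end point `j`, for which `z` is the sum of the label and the variable, is
equal to `b`. -/
def argMark (deg : Fin n → ℕ) (t : Fin n → Bool) (b : Bool) (j : Fin n) (z : Answer n) : Bool :=
  (if deg j = 0 then !(z.val == 1) else literal (t j) (z.val == 1)) == b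

variable (G : Circuit n) (x : ℕ → Bool)

theorem fresh_iff (visited : Fin n → Bool) (i k : Fin n) :
    G.Fresh visited i k ↔
      k.val < G.deg i ∧ Marked (G.oracle x) i (freshMark G.deg visited) k := by
  unfold Circuit.Fresh Marked freshMark
  constructor
  · rintro ⟨j, hj, hv, hd⟩
    rw [G.toVertex_target x hj]
    exact ⟨(List.getElem?_eq_some_iff.1 hj).1, by simp [hv, hd]⟩
  · rintro ⟨hk, h⟩
    have hj : (G.adj i)[k.val]? = some ((G.adj i)[k.val]'hk) := List.getElem?_eq_getElem hk
    rw [G.toVertex_target x hj] at h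
    exact ⟨_, hj, by simpa using h⟩

/-- At a sink the literal is true exactly if label and variable agree, that is, if their sum is not
`1`. At a non-sink the variable position holds zero, so the sum is the label itself, and the value
is taken from the table. -/
theorem argEq_iff (t : Fin n → Bool) (i : Fin n) (b : Bool) (k : Fin n) :
    G.ArgEq x t i b k ↔
      k.val < G.deg i ∧ Marked (G.oracle x) i (argMark G.deg t b) k := by
  have key : ∀ j, (G.adj i)[k.val]? = some j →
      (Marked (G.oracle x) i (argMark G.deg t b) k ↔
        literal (G.tableValue x t j) (G.σ i j) = b) := by
    intro j hj
    have hadd : (G.oracle x (.label i k) + G.oracle x (.var j)).val =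
        (G.σ i j).toNat + if G.deg j = 0 then (x (G.var j)).toNat else 0 := by
      -- No reduction modulo `n + 2` takes place: the sum is at most `2`, and `n ≥ 1`.
      rw [Fin.val_add, G.oracle_label x hj, G.oracle_var]
      refine Nat.mod_eq_of_lt ?_
      have h1 := (G.σ i j).toNat_lt
      have h2 := (x (G.var j)).toNat_lt
      have := i.pos
      split_ifs <;> omega
    unfold Marked
    rw [G.toVertex_target x hj]
    unfold argMark Circuit.tableValue
    rw [hadd, beq_iff_eq]
    by_cases h : G.deg j = 0
    · simp only [h, if_true]
      cases G.σ i j <;> cases x (G.var j) <;> simp [literal]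
    · simp only [h, if_false]
      cases G.σ i j <;> simp
  constructor
  · rintro ⟨j, hj, h⟩
    exact ⟨(List.getElem?_eq_some_iff.1 hj).1, (key j hj).2 h⟩
  · rintro ⟨hk, h⟩
    have hj : (G.adj i)[k.val]? = some ((G.adj i)[k.val]'hk) := List.getElem?_eq_getElem hk
    exact ⟨_, hj, (key _ hj).1 h⟩

end QQuery.Grover

open QQuery.Grover FirstSearch

/-- The search for fresh positions in the list of `i` from `lo` to `hi - 1`. -/
noncomputable def freshSearch {n : ℕ} (deg : Fin n → ℕ) (visited : Fin n → Bool) (i : Fin n)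
    (r lo hi : ℕ) : CProg n (Option (Fin n)) :=
  find i (positions deg i lo hi) (freshMark deg visited) r

/-- Subroutines by Grover's algorithm. -/
noncomputable def groverSubroutines : Subroutines where
  firstOne deg visited i start :=
    window (freshSearch deg visited i) (2 * Nat.clog 2 (numNonsinks deg) + 1) (deg i) (deg i) 0
      start
  search deg t i b := find i (positions deg i 0 (deg i)) (argMark deg t b) 1

section Specs

variable {n : ℕ} (G : Circuit n) (x : ℕ → Bool)

theorem searchSpec_groverSubroutines {c : ℝ} (hc : 81 ≤ c) : groverSubroutines.SearchSpec c := by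
  intro n G x t i b
  have hmem : ∀ k, k ∈ positions G.deg i 0 (G.deg i) ∧
      Marked (G.oracle x) i (argMark G.deg t b) k ↔ G.ArgEq x t i b k := by
    intro k
    rw [argEq_iff]
    simp [positions]
  constructor
  · intro ω hω
    obtain ⟨h1, h2⟩ := ensures_find (G.oracle x) i (positions G.deg i 0 (G.deg i))
      (argMark G.deg t b) 1 ω hω
    refine ⟨h1.trans ?_, fun z hz => (hmem z).1 (h2 z hz)⟩
    have hcard : ((positions G.deg i 0 (G.deg i)).card : ℝ) ≤ G.deg i := by
      exact_mod_cast card_positions_le G.deg i 0 (G.deg i)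
    rw [Nat.cast_one, mul_one]
    exact mul_le_mul hc (Real.sqrt_le_sqrt hcard) (Real.sqrt_nonneg _) (by linarith)
  · rintro ⟨k, hk⟩
    have := errProb_find_le (G.oracle x) i (positions G.deg i 0 (G.deg i)) (argMark G.deg t b) 1
      ⟨k, (hmem k).2 hk⟩
    rw [pow_one] at this
    refine le_trans (le_of_eq ?_) this
    unfold Prog.errProb
    congr 1
    ext ω
    simp

variable (visited : Fin n → Bool) (i : Fin n)

theorem ensures_freshSearch (r lo k : ℕ) :
    (freshSearch G.deg visited i r lo (lo + 2 ^ k)).Ensures (G.oracle x) fun z q =>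
      (q : ℝ) ≤ 81 * r * √(2 ^ k : ℝ) ∧
        ∀ k' ∈ z, lo ≤ k'.val ∧ k'.val < lo + 2 ^ k ∧ G.Fresh visited i k' := by
  refine (ensures_find _ _ _ _ _).mono ?_
  rintro z q ⟨hq, hz⟩
  constructor
  · refine hq.trans (mul_le_mul_of_nonneg_left (Real.sqrt_le_sqrt ?_) (by positivity))
    have := card_positions_le G.deg i lo (lo + 2 ^ k)
    rw [Nat.add_sub_cancel_left] at this
    exact_mod_cast this
  · intro k' hk'
    obtain ⟨h1, h2⟩ := hz k' hk'
    simp only [positions, Finset.mem_filter, Finset.mem_univ, true_and] at h1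
    exact ⟨h1.1, h1.2.1, (fresh_iff G x visited i k').2 ⟨h1.2.2, h2⟩⟩

theorem errProb_freshSearch_le (r lo k : ℕ)
    (h : ∃ k' : Fin n, lo ≤ k'.val ∧ k'.val < lo + 2 ^ k ∧ G.Fresh visited i k') :
    (freshSearch G.deg visited i r lo (lo + 2 ^ k)).errProb (G.oracle x) {none}ᶜ ≤
      (1 / 2) ^ r := by
  obtain ⟨k', h1, h2, h3⟩ := h
  rw [fresh_iff G x] at h3
  exact errProb_find_le _ _ _ _ _ ⟨k', by simp [positions, h1, h2, h3.1], h3.2⟩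

/-- What the search finds is a non-visited non-sink. -/
theorem ensures_firstOne (start : ℕ) :
    (groverSubroutines.firstOne G.deg visited i start).Ensures (G.oracle x) fun z q =>
      (q : ℝ) ≤ 81 * (2 * Nat.clog 2 G.nhat + 1 : ℕ) * (17 * √(G.passed i start z)) ∧
        ∀ k ∈ z, start ≤ k.val ∧ G.Fresh visited i k := by
  refine (ensures_window (ensures_freshSearch G x visited i) (Nat.le_add_left 1 _) (G.deg i) start
    (G.deg i) 0 start (by simp)).mono ?_
  rintro z q ⟨hq, hz⟩
  refine ⟨?_, hz⟩
  have h : distance (G.deg i) start z = G.passed i start z := by cases z <;> rfl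
  rw [h] at hq
  rcases hq with rfl | hq
  · push_cast; positivity
  · refine hq.trans (mul_le_mul_of_nonneg_left ?_ (by positivity))
    linarith [Real.sqrt_nonneg (2 ^ 0 : ℝ)]

theorem half_pow_clog_le {N : ℕ} (hN : 0 < N) :
    (1 / 2 : ℝ≥0∞) ^ (2 * Nat.clog 2 N) ≤ ENNReal.ofReal (1 / (N : ℝ) ^ 2) := by
  have hN' : (0 : ℝ) < N := by exact_mod_cast hN
  rw [show (1 / 2 : ℝ≥0∞) = ENNReal.ofReal (1 / 2) by
    rw [ENNReal.ofReal_div_of_pos (by norm_num)]; simp, ← ENNReal.ofReal_pow (by norm_num)]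
  refine ENNReal.ofReal_le_ofReal ?_
  rw [one_div_pow]
  refine one_div_le_one_div_of_le (by positivity) ?_
  rw [mul_comm, pow_mul]
  have : (N : ℝ) ≤ 2 ^ Nat.clog 2 N := by exact_mod_cast Nat.le_pow_clog (by norm_num) N
  gcongr

/-- The correct answer is named as a single `z`, as needed to follow the ideal run. If nothing is
fresh, `none` is returned with certainty. -/
theorem exists_isFirstFresh_errProb_le (start : ℕ) (h2 : 2 ≤ G.nhat) :
    ∃ z, G.IsFirstFresh visited i start z ∧
      (groverSubroutines.firstOne G.deg visited i start).errProb (G.oracle x) {z} ≤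
        ENNReal.ofReal (1 / (G.nhat : ℝ) ^ 2) := by
  classical
  by_cases h : ∃ k : ℕ, ∃ hk : k < n, start ≤ k ∧ G.Fresh visited i ⟨k, hk⟩
  · obtain ⟨hk, hs, hf⟩ := Nat.find_spec h
    have hmin : ∀ k' : Fin n, start ≤ k'.val → G.Fresh visited i k' →
        (⟨Nat.find h, hk⟩ : Fin n) ≤ k' :=
      fun k' h1 h2 => Fin.le_def.2 (Nat.find_min' h ⟨k'.2, h1, h2⟩)
    refine ⟨some ⟨Nat.find h, hk⟩, ⟨hs, hf, fun k' h1 h2 h3 => (hmin k' h1 h3).not_gt h2⟩, ?_⟩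
    exact (errProb_window_le (ensures_freshSearch G x visited i)
      (errProb_freshSearch_le G x visited i) hf ((fresh_iff G x visited i _).1 hf).1 _ _ 0 start hs
      hmin (Nat.le_add_left _ _)).trans (half_pow_clog_le (N := G.nhat) (by omega))
  · refine ⟨none, fun k h1 h2 => h ⟨k.val, k.2, h1, h2⟩, ?_⟩
    rw [Prog.errProb_eq_zero ((ensures_firstOne G x visited i start).mono ?_)]
    · exact zero_le
    · rintro (_ | k) q ⟨-, hk⟩
      · simp
      · exact absurd ⟨k.val, k.2, hk k rfl⟩ h

theorem clog_le_log {N : ℕ} (hN : 2 ≤ N) :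
    ((2 * Nat.clog 2 N + 1 : ℕ) : ℝ) ≤ 8 * Real.log N := by
  have hN' : (2 : ℝ) ≤ N := by exact_mod_cast hN
  have hl2 := Real.log_two_gt_d9
  have hlog : Real.log 2 ≤ Real.log N := Real.log_le_log (by norm_num) hN'
  obtain ⟨m, hm⟩ : ∃ m, Nat.clog 2 N = m + 1 :=
    ⟨Nat.clog 2 N - 1, by have := Nat.clog_pos (b := 2) (by norm_num) hN; omega⟩
  have hlt : 2 ^ m < N := (Nat.lt_clog_iff_pow_lt (b := 2) (by norm_num)).1 (by omega)
  have h3 : (m : ℝ) * Real.log 2 ≤ Real.log N := by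
    rw [← Real.log_pow]
    exact Real.log_le_log (by positivity) (by exact_mod_cast hlt.le)
  rw [hm]
  push_cast
  nlinarith

/-- `11016 = 81 * 8 * 17`, with `8` from `clog_le_log` and the other factors from `ensures_window`.
-/
theorem firstOneSpec_groverSubroutines {c : ℝ} (hc : 11016 ≤ c) :
    groverSubroutines.FirstOneSpec c := by
  intro n G x visited i start h2
  constructor
  · intro ω hω
    refine (ensures_firstOne G x visited i start ω hω).1.trans ?_
    have h1 := clog_le_log h2
    have h3 := Real.sqrt_nonneg (G.passed i start ω.1)
    have h4 : 0 ≤ Real.log G.nhat := Real.log_natCast_nonneg _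
    calc 81 * ((2 * Nat.clog 2 G.nhat + 1 : ℕ) : ℝ) * (17 * √(G.passed i start ω.1))
        ≤ 81 * (8 * Real.log G.nhat) * (17 * √(G.passed i start ω.1)) := by gcongr
      _ = 11016 * √(G.passed i start ω.1) * Real.log G.nhat := by ring
      _ ≤ c * √(G.passed i start ω.1) * Real.log G.nhat := by gcongr
  · obtain ⟨z, hz, hp⟩ := exists_isFirstFresh_errProb_le G x visited i start h2
    refine le_trans (MeasureTheory.measure_mono ?_) hp
    intro ω hω h
    rw [Set.mem_singleton_iff] at h
    exact hω (h ▸ hz)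

end Specs

/-! # Depth-first search -/

/-- The search finds only non-visited non-sinks. -/
def Subroutines.FirstOneSound (S : Subroutines) : Prop :=
  ∀ {n : ℕ} (G : Circuit n) (x : ℕ → Bool) (visited : Fin n → Bool) (i : Fin n) (start : ℕ),
    (S.firstOne G.deg visited i start).Ensures (G.oracle x) fun z _ =>
      ∀ k ∈ z, start ≤ k.val ∧ G.Fresh visited i k

/-- AM-GM for `l` and `p / l`. It makes the cost of a search linear in the number of passed
positions, so that the costs of all searches in a list can be added; the optimal `l` is chosen at
the end. -/
theorem sqrt_le_half_add {l p : ℝ} (hl : 0 < l) (hp : 0 ≤ p) : √p ≤ (l + p / l) / 2 := by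
  rw [Real.sqrt_le_iff]
  refine ⟨by positivity, ?_⟩
  have h : p = l * (p / l) := by field_simp
  nlinarith [sq_nonneg (l - p / l)]

namespace Circuit

variable {n : ℕ} (G : Circuit n) (x : ℕ → Bool)

theorem ensures_getTarget {i k j : Fin n} (h : (G.adj i)[k.val]? = some j) :
    (getTarget i k).Ensures (G.oracle x) fun a q => a = j ∧ q = 1 :=
  Prog.ensures_query_bind (Prog.ensures_ret ⟨G.toVertex_target x h, rfl⟩)

theorem errProb_getTarget {i k j : Fin n} (h : (G.adj i)[k.val]? = some j) :
    (getTarget i k).errProb (G.oracle x) {j} = 0 :=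
  Prog.errProb_eq_zero ((G.ensures_getTarget x h).mono fun _ _ h => h.1)

theorem exists_position {i j : Fin n} (h : j ∈ G.adj i) :
    ∃ k : Fin n, (G.adj i)[k.val]? = some j := by
  obtain ⟨k, hk, rfl⟩ := List.getElem_of_mem h
  have hn : (G.adj i).length ≤ n := by simpa using (G.nodup i).length_le_card
  exact ⟨⟨k, hk.trans_le hn⟩, List.getElem?_eq_getElem hk⟩

/-- The sum of `w` over the non-visited non-sinks. -/
def pending {M : Type} [AddCommMonoid M] (w : Fin n → M) (visited : Fin n → Bool) : M :=
  ∑ v, if visited v = false ∧ 0 < G.deg v then w v else 0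

theorem pending_update {M : Type} [AddCommMonoid M] (w : Fin n → M) {visited : Fin n → Bool}
    {i : Fin n} (hi : visited i = false) (hd : 0 < G.deg i) :
    G.pending w (Function.update visited i true) + w i = G.pending w visited := by
  unfold pending
  rw [← Finset.sum_erase_add Finset.univ _ (Finset.mem_univ i),
    ← Finset.sum_erase_add Finset.univ (fun v => if visited v = false ∧ 0 < G.deg v then w v else 0)
      (Finset.mem_univ i)]
  simp only [Function.update_self, Bool.true_eq_false, false_and, if_false, add_zero, hi, hd,
    and_self, if_true]
  congr 1
  refine Finset.sum_congr rfl fun v hv => ?_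
  rw [Function.update_of_ne (Finset.ne_of_mem_erase hv)]

theorem pending_update_of_sink {M : Type} [AddCommMonoid M] (w : Fin n → M)
    {visited : Fin n → Bool} {i : Fin n} (hd : ¬ 0 < G.deg i) :
    G.pending w (Function.update visited i true) = G.pending w visited := by
  refine Finset.sum_congr rfl fun v _ => ?_
  rcases eq_or_ne v i with rfl | hv
  · simp [hd]
  · rw [Function.update_of_ne hv]

/-- Every call of the depth-first search at a non-visited vertex decreases this number, so the bound
on the recursion depth is never exhausted. -/
def numUnvisited (visited : Fin n → Bool) : ℕ :=
  (Finset.univ.filter fun v => visited v = false).card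

theorem numUnvisited_le (visited : Fin n → Bool) : numUnvisited visited ≤ n :=
  (Finset.card_filter_le _ _).trans (by simp)

theorem numUnvisited_mono {visited visited' : Fin n → Bool}
    (h : ∀ v, visited v = true → visited' v = true) :
    numUnvisited visited' ≤ numUnvisited visited := by
  refine Finset.card_le_card fun v => ?_
  simp only [Finset.mem_filter, Finset.mem_univ, true_and]
  intro hv
  by_contra hn
  simp [h v (by simpa using hn)] at hv

theorem numUnvisited_update_lt {visited : Fin n → Bool} {i : Fin n} (hi : visited i = false) :
    numUnvisited (Function.update visited i true) < numUnvisited visited := by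
  refine Finset.card_lt_card (Finset.ssubset_iff_of_subset ?_ |>.2 ⟨i, by simp [hi], by simp⟩)
  intro v
  simp only [Finset.mem_filter, Finset.mem_univ, true_and]
  rcases eq_or_ne v i with rfl | hv
  · simp
  · rw [Function.update_of_ne hv]; exact id

theorem update_mono (visited : Fin n → Bool) (i v : Fin n) (h : visited v = true) :
    Function.update visited i true v = true := by
  rcases eq_or_ne v i with rfl | hv
  · simp
  · rwa [Function.update_of_ne hv]

end Circuit

open Subroutines Circuit

/-! ## Running time -/

section Cost

variable {n : ℕ} (S : Subroutines) (G : Circuit n) (x : ℕ → Bool) {c : ℝ} {l : ℝ} (e : Fin n → ℝ)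

/-- The charge for a non-sink: two searches that pass all of its list, one classical query, and
`e` for the later evaluation. -/
noncomputable def charge (K l : ℝ) (v : Fin n) : ℝ :=
  K / 2 * (2 * l + G.deg v / l) + 1 + e v

/-- The unspent credit: non-visited non-sinks hold their full charge, and finished ones keep `e` for
the evaluation. -/
noncomputable def potential (K l : ℝ) (st : DFSState n) : ℝ :=
  G.pending (charge G e K l) st.visited + (st.order.map e).sum

variable {S} (hS : S.FirstOneSpec c) (hS' : S.FirstOneSound) (hc : 0 ≤ c) (hl : 0 < l)
  (h2 : 2 ≤ G.nhat)

theorem passed_nonneg {i : Fin n} {start : ℕ} (hs : start ≤ G.deg i) {z : Option (Fin n)}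
    (hz : ∀ k ∈ z, start ≤ k.val) : 0 ≤ G.passed i start z := by
  rcases z with _ | z
  · have : (start : ℝ) ≤ G.deg i := by exact_mod_cast hs
    simp only [passed]
    linarith
  · have : (start : ℝ) ≤ z.val := by exact_mod_cast hz z rfl
    simp only [passed]
    linarith

include hS hS' hc hl h2 in
theorem ensures_firstOne_cost (visited : Fin n → Bool) (i : Fin n) {start : ℕ}
    (hs : start ≤ G.deg i) :
    (S.firstOne G.deg visited i start).Ensures (G.oracle x) fun z q =>
      (q : ℝ) ≤ c * Real.log G.nhat / 2 * (l + G.passed i start z / l) ∧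
        ∀ k ∈ z, start ≤ k.val ∧ G.Fresh visited i k := by
  intro ω hω
  have h1 := (hS G x visited i start h2).1 ω hω
  have h3 := hS' G x visited i start ω hω
  refine ⟨h1.trans ?_, h3⟩
  have h4 := sqrt_le_half_add hl (passed_nonneg G hs fun k hk => (h3 k hk).1)
  have h5 : 0 ≤ c * Real.log G.nhat := mul_nonneg hc (Real.log_natCast_nonneg _)
  nlinarith [mul_le_mul_of_nonneg_left h4 h5]

include hS hS' hc hl h2 in
-- The scan of a list is allowed `K / 2 * l` for its last search and `K / 2 * (deg - start) / l` for
-- all passed positions. A search that discovers a vertex, and the query of its end point, are paid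
-- by that vertex: `rec` leaves a surplus of `K / 2 * l + 1`.
theorem ensures_scan {D : ℕ} {rec : Fin n → DFSState n → CProg n (DFSState n)}
    (hrec : ∀ j st, st.visited j = false → 0 < G.deg j → numUnvisited st.visited ≤ D →
      (rec j st).Ensures (G.oracle x) fun st' q =>
        q + potential G e (c * Real.log G.nhat) l st' + c * Real.log G.nhat / 2 * l + 1 ≤
          potential G e (c * Real.log G.nhat) l st ∧
        ∀ v, st.visited v = true → st'.visited v = true)
    (i : Fin n) (rounds start : ℕ) (st : DFSState n) (hs : start ≤ G.deg i)
    (hD : numUnvisited st.visited ≤ D) :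
    (scan S G.deg rec i rounds start st).Ensures (G.oracle x) fun st' q =>
      q + potential G e (c * Real.log G.nhat) l st' ≤ potential G e (c * Real.log G.nhat) l st +
        c * Real.log G.nhat / 2 * (l + ((G.deg i : ℝ) - start) / l) ∧
      ∀ v, st.visited v = true → st'.visited v = true := by
  have hK : 0 ≤ c * Real.log G.nhat := mul_nonneg hc (Real.log_natCast_nonneg _)
  induction rounds generalizing start st with
  | zero =>
    refine Prog.ensures_ret ⟨?_, fun _ h => h⟩
    have : 0 ≤ (G.deg i : ℝ) - start := sub_nonneg.2 (by exact_mod_cast hs)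
    have : 0 ≤ c * Real.log G.nhat / 2 * (l + ((G.deg i : ℝ) - start) / l) := by positivity
    push_cast
    linarith
  | succ rounds ih =>
    rw [scan]
    refine (ensures_firstOne_cost G x hS hS' hc hl h2 st.visited i hs).bind ?_
    rintro (_ | z) q₁ ⟨hq₁, hz⟩
    · refine Prog.ensures_ret ⟨?_, fun _ h => h⟩
      simp only [passed] at hq₁
      push_cast
      linarith
    · obtain ⟨hsz, j, hj, hv, hd⟩ := hz z rfl
      refine (G.ensures_getTarget x hj).bind ?_
      rintro _ _ ⟨rfl, rfl⟩
      refine (hrec _ st hv hd hD).bind ?_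
      rintro st' q₂ ⟨hq₂, hmono⟩
      have hzd : z.val < G.deg i := (List.getElem?_eq_some_iff.1 hj).1
      refine (ih (z.val + 1) st' hzd ((numUnvisited_mono hmono).trans hD)).mono ?_
      rintro st'' q₃ ⟨hq₃, hmono'⟩
      refine ⟨?_, fun v hv => hmono' v (hmono v hv)⟩
      simp only [passed] at hq₁
      -- The passed positions add up; the extra `K / 2 * l` is the surplus left by the recursive
      -- call.
      have hsplit : c * Real.log G.nhat / 2 * (l + ((z.val : ℝ) + 1 - start) / l) +
          c * Real.log G.nhat / 2 * (l + ((G.deg i : ℝ) - (z.val + 1 : ℕ)) / l) =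
          c * Real.log G.nhat / 2 * (l + ((G.deg i : ℝ) - start) / l) +
          c * Real.log G.nhat / 2 * l := by
        push_cast
        field_simp
        ring
      push_cast at *
      linarith

include hS hS' hc hl h2 in
theorem ensures_topSortDFS (depth : ℕ) (i : Fin n) (st : DFSState n)
    (hi : st.visited i = false) (hd : 0 < G.deg i) (hdepth : numUnvisited st.visited ≤ depth) :
    (topSortDFS S G.deg depth i st).Ensures (G.oracle x) fun st' q =>
      q + potential G e (c * Real.log G.nhat) l st' + c * Real.log G.nhat / 2 * l + 1 ≤
        potential G e (c * Real.log G.nhat) l st ∧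
      ∀ v, st.visited v = true → st'.visited v = true := by
  induction depth generalizing i st with
  | zero =>
    have := numUnvisited_update_lt hi
    omega
  | succ depth ih =>
    rw [topSortDFS]
    simp only [if_pos hd]
    have hlt := numUnvisited_update_lt hi
    refine (ensures_scan G x e hS hS' hc hl h2 (D := depth) (fun j st h1 h3 h4 => ih j st h1 h3 h4)
      i (n + 1) 0 ⟨Function.update st.visited i true, st.order⟩ (Nat.zero_le _)
      (by show numUnvisited (Function.update st.visited i true) ≤ depth; omega)).bind ?_
    rintro st₂ q ⟨hq, hmono⟩
    refine Prog.ensures_ret ⟨?_, fun v hv => hmono v (update_mono _ _ _ hv)⟩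
    have h := G.pending_update (charge G e (c * Real.log G.nhat) l) hi hd
    simp only [potential, List.map_cons, List.sum_cons, charge, Nat.cast_zero, sub_zero,
      add_zero] at *
    have : c * Real.log G.nhat / 2 * (l + (G.deg i : ℝ) / l) + c * Real.log G.nhat / 2 * l =
      c * Real.log G.nhat / 2 * (2 * l + (G.deg i : ℝ) / l) := by ring
    linarith

include hS hS' hc hl h2 in
theorem ensures_topSortFrom (starts : List (Fin n)) (st : DFSState n) :
    (topSortFrom S G.deg starts st).Ensures (G.oracle x) fun st' q =>
      q + potential G e (c * Real.log G.nhat) l st' ≤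
        potential G e (c * Real.log G.nhat) l st := by
  have hK : 0 ≤ c * Real.log G.nhat := mul_nonneg hc (Real.log_natCast_nonneg _)
  induction starts generalizing st with
  | nil => exact Prog.ensures_ret (by simp)
  | cons i starts ih =>
    rw [topSortFrom]
    split_ifs with hi
    · exact ih st
    · by_cases hd : 0 < G.deg i
      · refine (ensures_topSortDFS G x e hS hS' hc hl h2 (n + 1) i st (by simpa using hi) hd
          ((numUnvisited_le _).trans (Nat.le_succ _))).bind ?_
        rintro st' q ⟨hq, -⟩
        refine (ih st').mono fun st'' q' h => ?_
        have : 0 ≤ c * Real.log G.nhat / 2 * l := by positivity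
        push_cast
        linarith
      · rw [topSortDFS]
        simp only [if_neg hd]
        refine (ih _).mono fun st'' q' h => ?_
        simpa only [potential, G.pending_update_of_sink _ hd] using h

include hS hS' hc hl h2 in
theorem ensures_topSort (he : ∀ v, 0 ≤ e v) (starts : List (Fin n)) :
    (topSort S G.deg starts).Ensures (G.oracle x) fun order q =>
      q + (order.map e).sum ≤
        ∑ v, if 0 < G.deg v then charge G e (c * Real.log G.nhat) l v else 0 := by
  have hK : 0 ≤ c * Real.log G.nhat := mul_nonneg hc (Real.log_natCast_nonneg _)
  refine (ensures_topSortFrom G x e hS hS' hc hl h2 starts ⟨fun _ => false, []⟩).bind ?_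
  rintro st q hq
  refine Prog.ensures_ret ?_
  have h0 : 0 ≤ G.pending (charge G e (c * Real.log G.nhat) l) st.visited :=
    Finset.sum_nonneg fun v _ => by
      have := he v
      unfold charge
      split_ifs <;> positivity
  simp only [potential, pending, List.map_nil, List.sum_nil, true_and, add_zero] at hq h0
  push_cast
  linarith

end Cost

/-! ## Correctness -/

section Correctness

variable {n : ℕ} (G : Circuit n) (x : ℕ → Bool)

/-- Each vertex of the list comes before all non-sinks among its out-neighbours. -/
def Closed : List (Fin n) → Prop
  | [] => True
  | i :: order => (∀ j ∈ G.adj i, 0 < G.deg j → j ∈ order) ∧ Closed order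

theorem Closed.mem {order : List (Fin n)} (h : Closed G order) {i j : Fin n} (hi : i ∈ order)
    (hj : j ∈ G.adj i) (hd : 0 < G.deg j) : j ∈ order := by
  induction order with
  | nil => simp at hi
  | cons a order ih =>
    rcases List.mem_cons.1 hi with rfl | hi
    · exact List.mem_cons_of_mem _ (h.1 j hj hd)
    · exact List.mem_cons_of_mem _ (ih h.2 hi)

/-- A visited non-sink the search from which is not finished. -/
def Active (st : DFSState n) (v : Fin n) : Prop :=
  st.visited v = true ∧ 0 < G.deg v ∧ v ∉ st.order

/-- The search may pass from `st` to `st'`. -/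
structure Extends (st st' : DFSState n) : Prop where
  visited : ∀ v, st.visited v = true → st'.visited v = true
  closed : Closed G st'.order
  active : ∀ v, Active G st' v → Active G st v
  length : st'.order.length + G.pending (fun _ => 1) st'.visited ≤
    st.order.length + G.pending (fun _ => 1) st.visited

theorem Extends.trans {st st' st'' : DFSState n} (h : Extends G st st') (h' : Extends G st' st'') :
    Extends G st st'' :=
  ⟨fun v hv => h'.visited v (h.visited v hv), h'.closed, fun v hv => h.active v (h'.active v hv),
    h'.length.trans h.length⟩

variable {S : Subroutines} {ε : ℝ≥0∞}
  (hS : ∀ (visited : Fin n → Bool) (i : Fin n) (start : ℕ), ∃ z,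
    G.IsFirstFresh visited i start z ∧
      (S.firstOne G.deg visited i start).errProb (G.oracle x) {z} ≤ ε)

include hS in
-- `st'` is the state after a run without errors and `N` bounds its number of searches. Each newly
-- visited non-sink accounts for two of them, the one that discovers it and the last one in its
-- list; the `+ 1` here is the last search in the list of `i`. The hypothesis `hr` ensures that the
-- rounds suffice to pass all positions.
theorem exists_scan {D : ℕ} {rec : Fin n → DFSState n → CProg n (DFSState n)}
    (hrec : ∀ j st, st.visited j = false → 0 < G.deg j → numUnvisited st.visited ≤ D →
      Closed G st.order → (∀ v, Active G st v → G.Reachable v j) →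
      ∃ (st' : DFSState n) (N : ℕ), (rec j st).errProb (G.oracle x) {st'} ≤ N * ε ∧
        N + 2 * G.pending (fun _ => 1) st'.visited + 1 ≤ 2 * G.pending (fun _ => 1) st.visited ∧
        Extends G st st' ∧ st'.visited j = true)
    (i : Fin n) (rounds start : ℕ) (st : DFSState n) (hr : n < rounds + start)
    (hD : numUnvisited st.visited ≤ D) (hcl : Closed G st.order)
    (hact : ∀ v, Active G st v → G.Reachable v i)
    (hstart : ∀ k : Fin n, k.val < start → ¬ G.Fresh st.visited i k) :
    ∃ (st' : DFSState n) (N : ℕ),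
      (scan S G.deg rec i rounds start st).errProb (G.oracle x) {st'} ≤ N * ε ∧
      N + 2 * G.pending (fun _ => 1) st'.visited ≤ 2 * G.pending (fun _ => 1) st.visited + 1 ∧
      Extends G st st' ∧ ∀ j ∈ G.adj i, 0 < G.deg j → st'.visited j = true := by
  have hdone : ∀ st : DFSState n, (∀ k : Fin n, ¬ G.Fresh st.visited i k) →
      ∀ j ∈ G.adj i, 0 < G.deg j → st.visited j = true := by
    intro st hf j hj hd
    obtain ⟨k, hk⟩ := G.exists_position hj
    by_contra hv
    exact hf k ⟨j, hk, by simpa using hv, hd⟩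
  induction rounds generalizing start st with
  | zero =>
    exact ⟨st, 0, (Prog.errProb_ret (Set.mem_singleton st)).trans_le zero_le, by omega,
      ⟨fun _ h => h, hcl, fun _ h => h, le_rfl⟩, hdone st fun k => hstart k (by omega)⟩
  | succ rounds ih =>
    obtain ⟨z, hz, hp⟩ := hS st.visited i start
    rcases z with _ | z
    · refine ⟨st, 1, ?_, by omega, ⟨fun _ h => h, hcl, fun _ h => h, le_rfl⟩,
        hdone st fun k => ?_⟩
      · rw [scan]
        refine (Prog.errProb_bind_singleton none).trans ?_
        rw [Prog.errProb_ret (Set.mem_singleton st), add_zero, Nat.cast_one, one_mul]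
        exact hp
      · exact (lt_or_ge k.val start).elim (hstart k) (hz k)
    · obtain ⟨hsz, ⟨j, hj, hv, hd⟩, hmin⟩ := hz
      have hadj : j ∈ G.adj i := List.mem_of_getElem? hj
      obtain ⟨st', N, hp', hN, hext, hvj⟩ := hrec j st hv hd hD hcl
        fun v hv => (hact v hv).tail hadj
      obtain ⟨st'', N', hp'', hN', hext', hch⟩ := ih (z.val + 1) st' (by omega)
        ((numUnvisited_mono hext.visited).trans hD) hext.closed
        (fun v hv => hact v (hext.active v hv)) (by
          -- Vertices remain visited, so no position passed earlier becomes fresh, and the position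
          -- `z` is no longer fresh because `j` is now visited.
          rintro k hk ⟨j', hj', hv', hd'⟩
          have hv₀ : st.visited j' = false := by
            by_contra hn
            simp [hext.visited j' (by simpa using hn)] at hv'
          rcases lt_or_ge k.val start with h | h
          · exact hstart k h ⟨j', hj', hv₀, hd'⟩
          · rcases lt_or_eq_of_le (Nat.lt_succ_iff.1 hk) with h' | h'
            · exact hmin k h (Fin.lt_def.2 h') ⟨j', hj', hv₀, hd'⟩
            · rw [h', hj, Option.some.injEq] at hj'
              subst hj'
              simp [hvj] at hv')
      refine ⟨st'', 1 + N + N', ?_, by omega, hext.trans G hext', hch⟩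
      rw [scan]
      refine (Prog.errProb_bind_singleton (some z)).trans ?_
      refine (add_le_add hp ((Prog.errProb_bind_singleton j).trans
        (add_le_add (G.errProb_getTarget x hj).le ((Prog.errProb_bind_singleton st').trans
          (add_le_add hp' hp''))))).trans (le_of_eq ?_)
      push_cast
      ring

include hS in
theorem exists_topSortDFS (depth : ℕ) (i : Fin n) (st : DFSState n)
    (hi : st.visited i = false) (hd : 0 < G.deg i) (hdepth : numUnvisited st.visited ≤ depth)
    (hcl : Closed G st.order) (hact : ∀ v, Active G st v → G.Reachable v i) :
    ∃ (st' : DFSState n) (N : ℕ),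
      (topSortDFS S G.deg depth i st).errProb (G.oracle x) {st'} ≤ N * ε ∧
      N + 2 * G.pending (fun _ => 1) st'.visited + 1 ≤ 2 * G.pending (fun _ => 1) st.visited ∧
      Extends G st st' ∧ st'.visited i = true := by
  induction depth generalizing i st with
  | zero =>
    have := numUnvisited_update_lt hi
    omega
  | succ depth ih =>
    have hlt := numUnvisited_update_lt hi
    have hpend := G.pending_update (fun _ => 1) hi hd
    have hact₁ : ∀ v, Active G ⟨Function.update st.visited i true, st.order⟩ v →
        v = i ∨ Active G st v := by
      rintro v ⟨h1, h3, h4⟩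
      rcases eq_or_ne v i with rfl | hv
      · exact Or.inl rfl
      · exact Or.inr ⟨by simpa [Function.update_of_ne hv] using h1, h3, h4⟩
    obtain ⟨st₂, N, hp, hN, hext, hch⟩ := exists_scan G x hS (D := depth)
      (fun j st h1 h3 h4 h5 h6 => ih j st h1 h3 h4 h5 h6) i (n + 1) 0
      ⟨Function.update st.visited i true, st.order⟩ (by omega)
      (by show numUnvisited (Function.update st.visited i true) ≤ depth; omega) hcl
      (fun v hv => (hact₁ v hv).elim (fun h => h ▸ Relation.ReflTransGen.refl) (hact v))
      (fun k hk => absurd hk (Nat.not_lt_zero _))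
    have hlen := hext.length
    have hvi : st₂.visited i = true := hext.visited i (by simp)
    simp only at hN hlen
    refine ⟨⟨st₂.visited, i :: st₂.order⟩, N, ?_, by simp only; omega,
      ⟨?_, ⟨?_, hext.closed⟩, ?_, ?_⟩,
      hvi⟩
    · rw [topSortDFS]
      simp only [if_pos hd]
      refine (Prog.errProb_bind_singleton st₂).trans ?_
      rw [Prog.errProb_ret (Set.mem_singleton _), add_zero]
      exact hp
    · exact fun v hv => hext.visited v (update_mono _ _ _ hv)
    -- All non-sink children are visited. One that is not yet in `order` would be active and hence
    -- reach `i`, which together with the edge from `i` would form a cycle.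
    · intro j hj hdj
      by_contra hn
      have hreach : G.Reachable j i :=
        (hact₁ j (hext.active j ⟨hch j hj hdj, hdj, hn⟩)).elim
          (fun h => h ▸ Relation.ReflTransGen.refl) (hact j)
      exact G.acyclic i (Relation.TransGen.head' hj hreach)
    · rintro v ⟨h1, h3, h4⟩
      simp only [List.mem_cons, not_or] at h4
      exact (hact₁ v (hext.active v ⟨h1, h3, h4.2⟩)).resolve_left h4.1
    · simp only [List.length_cons]
      omega

include hS in
theorem exists_topSortFrom (starts : List (Fin n)) (st : DFSState n) (hcl : Closed G st.order)
    (hact : ∀ v, ¬ Active G st v) :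
    ∃ (st' : DFSState n) (N : ℕ),
      (topSortFrom S G.deg starts st).errProb (G.oracle x) {st'} ≤ N * ε ∧
      N + 2 * G.pending (fun _ => 1) st'.visited ≤ 2 * G.pending (fun _ => 1) st.visited ∧
      Extends G st st' ∧ ∀ u ∈ starts, st'.visited u = true := by
  induction starts generalizing st with
  | nil =>
    exact ⟨st, 0, (Prog.errProb_ret (Set.mem_singleton st)).trans_le zero_le, by omega,
      ⟨fun _ h => h, hcl, fun _ h => h, le_rfl⟩, by simp⟩
  | cons i starts ih =>
    rw [topSortFrom]
    split_ifs with hi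
    · obtain ⟨st', N, h1, h3, h4, h5⟩ := ih st hcl hact
      refine ⟨st', N, h1, h3, h4, fun u hu => ?_⟩
      rcases List.mem_cons.1 hu with rfl | hu
      · exact h4.visited _ hi
      · exact h5 u hu
    · by_cases hd : 0 < G.deg i
      · obtain ⟨st', N, hp, hN, hext, hvi⟩ := exists_topSortDFS G x hS (n + 1) i st
          (by simpa using hi) hd ((numUnvisited_le _).trans (Nat.le_succ _)) hcl
          fun v hv => absurd hv (hact v)
        obtain ⟨st'', N', h1, h3, h4, h5⟩ := ih st' hext.closed
          fun v hv => hact v (hext.active v hv)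
        refine ⟨st'', N + N', ?_, by omega, hext.trans G h4, fun u hu => ?_⟩
        · refine (Prog.errProb_bind_singleton st').trans ((add_le_add hp h1).trans (le_of_eq ?_))
          push_cast
          ring
        · rcases List.mem_cons.1 hu with rfl | hu
          · exact h4.visited _ hvi
          · exact h5 u hu
      · have hpend := G.pending_update_of_sink (fun _ => 1) (visited := st.visited) hd
        have hact₁ : ∀ v, Active G ⟨Function.update st.visited i true, st.order⟩ v →
            Active G st v := by
          rintro v ⟨h1, h3, h4⟩
          have hv : v ≠ i := by rintro rfl; exact hd h3
          exact ⟨by simpa [Function.update_of_ne hv] using h1, h3, h4⟩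
        obtain ⟨st', N, h1, h3, h4, h5⟩ := ih ⟨Function.update st.visited i true, st.order⟩ hcl
          fun v hv => hact v (hact₁ v hv)
        have hlen := h4.length
        simp only at h3 hlen
        refine ⟨st', N, ?_, by omega, ⟨fun v hv => h4.visited v (update_mono _ _ _ hv), h4.closed,
          fun v hv => hact₁ v (h4.active v hv), by omega⟩, fun u hu => ?_⟩
        · rw [topSortDFS]
          simp only [if_neg hd]
          exact h1
        · rcases List.mem_cons.1 hu with rfl | hu
          · exact h4.visited _ (by simp)
          · exact h5 u hu

theorem pending_false : G.pending (fun _ => 1) (fun _ => false) = G.nhat := by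
  simp [pending, nhat, numNonsinks]

include hS in
-- At the end no vertex is active, so every visited non-sink is in `order`. Closedness then
-- propagates membership along a path from a start vertex to the root; all inner vertices of the
-- path are non-sinks.
theorem exists_topSort (starts : List (Fin n)) (root : Fin n)
    (hroot : ∃ u ∈ starts, G.Reachable u root) :
    ∃ order : List (Fin n),
      (topSort S G.deg starts).errProb (G.oracle x) {order} ≤ (2 * G.nhat : ℕ) * ε ∧
      order.length ≤ G.nhat ∧ Closed G order ∧ (0 < G.deg root → root ∈ order) := by
  obtain ⟨st, N, hp, hN, hext, hvis⟩ := exists_topSortFrom G x hS starts ⟨fun _ => false, []⟩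
    trivial (by rintro v ⟨h, -⟩; simp at h)
  have hlen := hext.length
  simp only [pending_false G, List.length_nil] at hN hlen
  refine ⟨st.order, ?_, by omega, hext.closed, fun hd => ?_⟩
  · refine (Prog.errProb_bind_singleton st).trans ?_
    rw [Prog.errProb_ret (Set.mem_singleton _), add_zero]
    refine hp.trans (mul_le_mul_left ?_ _)
    exact_mod_cast (by omega : N ≤ 2 * G.nhat)
  · obtain ⟨u, hu, hreach⟩ := hroot
    have hmem : ∀ v, 0 < G.deg v → st.visited v = true → v ∈ st.order := by
      intro v hdv hv
      by_contra hn
      simpa [Active] using hext.active v ⟨hv, hdv, hn⟩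
    have hprop : u = root ∨ u ∈ st.order := by
      rcases hreach.cases_head with h | ⟨v, hv, -⟩
      · exact Or.inl h
      · exact Or.inr (hmem u (List.length_pos_of_mem hv) (hvis u hu))
    rcases hprop with rfl | hu'
    · exact hmem _ hd (hvis _ hu)
    · clear hvis hu
      induction hreach using Relation.ReflTransGen.head_induction_on with
      | refl => exact hu'
      | head hv hrest ih =>
        refine ih (hext.closed.mem G hu' hv ?_)
        rcases hrest.cases_head with h | ⟨w, hw, -⟩
        · exact h ▸ hd
        · exact List.length_pos_of_mem hw

end Correctness

/-! # Evaluation of the gates -/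

namespace QQuery.Prog

variable {I A : Type} [Fintype I] [DecidableEq I] [Fintype A] [DecidableEq A] [AddCommGroup A]
  {α : Type} {x : I → A}

theorem ensures_replicate {p : Prog I A α} {B : ℝ} {P : α → Prop}
    (hp : p.Ensures x fun a q => (q : ℝ) ≤ B ∧ P a) (k : ℕ) :
    (p.replicate k).Ensures x fun l q => (q : ℝ) ≤ k * B ∧ ∀ a ∈ l, P a := by
  induction k with
  | zero => exact ensures_ret (by simp)
  | succ k ih =>
    refine hp.bind ?_
    rintro a q ⟨hq, ha⟩
    refine ih.bind ?_
    rintro l q' ⟨hq', hl⟩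
    refine ensures_ret ⟨?_, by simpa using ⟨ha, hl⟩⟩
    push_cast
    linarith

theorem errProb_replicate_le {p : Prog I A α} {S : Set α} (k : ℕ) :
    (p.replicate k).errProb x {l | ∃ a ∈ l, a ∈ S} ≤ p.errProb x S ^ k := by
  induction k with
  | zero => simpa using errProb_le_one _ _
  | succ k ih =>
    have h0 : ∀ a, ((p.replicate k).bind fun l => ret (a :: l)).errProb x
        {l | ∃ a ∈ l, a ∈ S} ≤ (p.replicate k).errProb x {l | ∃ a ∈ l, a ∈ S} := by
      intro a
      refine (errProb_bind_le_add (Q := fun _ _ => True) (fun _ _ => trivial) (ε := 0) ?_).trans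
        (add_zero _).le
      rintro l q - ⟨b, hb, hbS⟩
      exact (errProb_ret (S := {l | ∃ a ∈ l, a ∈ S}) ⟨b, List.mem_cons_of_mem _ hb, hbS⟩).le
    rw [pow_succ']
    refine (errProb_bind_le (S := S) (Q := fun _ _ => True) (fun _ _ => trivial)
      (δ := p.errProb x S ^ k) (ε := 0) (fun a _ _ _ => (h0 a).trans ih) ?_).trans (add_zero _).le
    intro a q _ ha
    refine (errProb_eq_zero ?_).le
    refine Ensures.bind (Q := fun _ _ => True) (fun _ _ => trivial) fun l q _ => ensures_ret ?_
    exact ⟨a, List.mem_cons_self, ha⟩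

end QQuery.Prog

namespace Gate

/-- The value of an argument that determines the value of the gate. -/
def target : Gate → Bool
  | and => false
  | or => true
  | nand => false

/-- The value of the gate if some argument is equal to `target`. -/
def hit : Gate → Bool
  | and => false
  | or => true
  | nand => true

theorem apply_eq (h : Gate) (l : List Bool) :
    h.apply l = if h.target ∈ l then h.hit else !h.hit := by
  cases h <;> induction l with
  | nil => simp [apply, target, hit]
  | cons a l ih =>
    simp only [apply, target, hit, List.all_cons, List.any_cons, id, List.mem_cons] at *
    cases a <;> simp_all

/-- The output `hit` is given only if a tested argument was found, hence it is reliable, and a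
single occurrence decides. -/
theorem combine_eq (h : Gate) (l : List Bool) :
    combine h l = if h.hit ∈ l then h.hit else !h.hit := by
  cases h <;> induction l with
  | nil => simp [combine, hit]
  | cons a l ih =>
    simp only [combine, hit, List.all_cons, List.any_cons, id, List.mem_cons] at *
    cases a <;> simp_all

theorem gateAlg_eq (S : Subroutines) {n : ℕ} (deg : Fin n → ℕ) (h : Gate) (t : Fin n → Bool)
    (i : Fin n) :
    gateAlg S deg h t i =
      (S.search deg t i h.target).bind fun r => .ret (if r.isSome then h.hit else !h.hit) := by
  cases h <;> simp only [gateAlg, target, hit] <;> congr 1 <;> funext r <;> cases r <;> simp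

end Gate

section Evaluation

variable {n : ℕ} (G : Circuit n) (x : ℕ → Bool)

/-- The gate as it is read by `getGate`. -/
def readGate (i : Fin n) : Gate := if G.deg i = 0 then .and else G.gate i

/-- The value at `i` that is computed from the table `t`. -/
def tableGate (t : Fin n → Bool) (i : Fin n) : Bool :=
  (readGate G i).apply ((G.adj i).map fun j => literal (G.tableValue x t j) (G.σ i j))

theorem target_mem_iff (t : Fin n → Bool) (i : Fin n) (b : Bool) :
    b ∈ (G.adj i).map (fun j => literal (G.tableValue x t j) (G.σ i j)) ↔
      ∃ k, G.ArgEq x t i b k := by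
  rw [List.mem_map]
  constructor
  · rintro ⟨j, hj, h⟩
    obtain ⟨k, hk⟩ := G.exists_position hj
    exact ⟨k, j, hk, h⟩
  · rintro ⟨k, j, hk, h⟩
    exact ⟨j, List.mem_of_getElem? hk, h⟩

theorem ensures_getGate (i : Fin n) :
    (getGate i).Ensures (G.oracle x) fun h q => h = readGate G i ∧ q = 1 := by
  refine Prog.ensures_query_bind (Prog.ensures_ret ⟨?_, rfl⟩)
  have := i.pos
  simp only [oracle, readGate, Fin.val_ofNat]
  split_ifs
  · simp [Gate.decode]
  · cases G.gate i
    · simp [Gate.decode, Gate.code]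
    · rw [Nat.mod_eq_of_lt (by simp [Gate.code])]; rfl
    · rw [Nat.mod_eq_of_lt (by simp only [Gate.code]; omega)]; rfl

theorem ensures_getVar {i : Fin n} (hi : G.deg i = 0) :
    (getVar i).Ensures (G.oracle x) fun b q => b = x (G.var i) ∧ q = 1 := by
  refine Prog.ensures_query_bind (Prog.ensures_ret ⟨?_, rfl⟩)
  rw [G.oracle_var, if_pos hi]
  cases x (G.var i) <;> rfl

variable {S : Subroutines} {c : ℝ} (hS : S.SearchSpec c)

include hS in
theorem ensures_gateAlg (h : Gate) (t : Fin n → Bool) (i : Fin n) :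
    (gateAlg S G.deg h t i).Ensures (G.oracle x) fun b q =>
      (q : ℝ) ≤ c * √(G.deg i) ∧ (b = h.hit → ∃ k, G.ArgEq x t i h.target k) := by
  rw [Gate.gateAlg_eq]
  refine Prog.Ensures.bind (Q := fun r q => (q : ℝ) ≤ c * √(G.deg i) ∧
    ∀ z ∈ r, G.ArgEq x t i h.target z) ((hS G x t i h.target).1) ?_
  rintro (_ | z) q ⟨hq, hz⟩
  · exact Prog.ensures_ret ⟨by simpa using hq, by simp⟩
  · exact Prog.ensures_ret ⟨by simpa using hq, fun _ => ⟨z, hz z rfl⟩⟩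

include hS in
theorem errProb_gateAlg_le (h : Gate) (t : Fin n → Bool) (i : Fin n)
    (hex : ∃ k, G.ArgEq x t i h.target k) :
    (gateAlg S G.deg h t i).errProb (G.oracle x) {h.hit} ≤ 1 / 2 := by
  rw [Gate.gateAlg_eq]
  refine (Prog.errProb_bind_le_add (S := {none}ᶜ) (Q := fun _ _ => True) (fun _ _ => trivial)
    (ε := 0) ?_).trans ((add_zero _).le.trans ?_)
  · rintro (_ | z) q - hne
    · simp at hne
    · exact (Prog.errProb_ret (by simp)).le
  · refine le_trans (le_of_eq ?_) ((hS G x t i h.target).2 hex)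
    unfold Prog.errProb
    congr 1
    ext ω
    simp

include hS in
theorem ensures_boosted (k : ℕ) (h : Gate) (t : Fin n → Bool) (i : Fin n) :
    (boosted S G.deg k h t i).Ensures (G.oracle x) fun _ q => (q : ℝ) ≤ k * (c * √(G.deg i)) :=
  (Prog.ensures_replicate (ensures_gateAlg G x hS h t i) k).bind fun _ _ h =>
    Prog.ensures_ret (by simpa using h.1)

include hS in
-- If a determining argument exists, an error requires all `k` searches to miss. If none exists, no
-- search can report one, and there is no error.
theorem errProb_boosted_le (k : ℕ) (t : Fin n → Bool) (i : Fin n) :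
    (boosted S G.deg k (readGate G i) t i).errProb (G.oracle x) {tableGate G x t i} ≤
      (1 / 2) ^ k := by
  rw [tableGate, Gate.apply_eq]
  by_cases hmem : (readGate G i).target ∈
      (G.adj i).map fun j => literal (G.tableValue x t j) (G.σ i j)
  · have hex := (target_mem_iff G x t i _).1 hmem
    rw [if_pos hmem]
    refine (Prog.errProb_bind_le_add (S := {l | ∃ a ∈ l, a ∈ ({(readGate G i).hit} : Set Bool)})
      (Q := fun _ _ => True) (fun _ _ => trivial) (ε := 0) ?_).trans ((add_zero _).le.trans
      ((Prog.errProb_replicate_le k).trans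
        (pow_le_pow_left' (errProb_gateAlg_le G x hS _ t i hex) k)))
    rintro l q - ⟨a, ha, rfl⟩
    refine (Prog.errProb_ret ?_).le
    rw [Gate.combine_eq, if_pos ha]
    rfl
  · have hex := mt (target_mem_iff G x t i _).2 hmem
    rw [if_neg hmem, Prog.errProb_eq_zero]
    · exact zero_le
    refine (Prog.ensures_replicate (ensures_gateAlg G x hS _ t i) k).bind ?_
    rintro l q ⟨-, hl⟩
    refine Prog.ensures_ret ?_
    rw [Gate.combine_eq, if_neg fun hmem => hex (hl _ hmem rfl)]
    rfl

include hS in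
theorem ensures_evalLoop (s : Fin n) (order : List (Fin n)) (t : Fin n → Bool) (hc : 0 ≤ c) :
    (evalLoop S G.deg s order t).Ensures (G.oracle x) fun _ q =>
      (q : ℝ) ≤ (order.map fun i =>
        1 + (⌈2 * Real.logb 2 G.nhat⌉₊ : ℝ) * (c * √(G.deg i))).sum := by
  induction order generalizing t with
  | nil => exact Prog.ensures_ret (by simp)
  | cons i order ih =>
    rw [evalLoop]
    refine (ensures_getGate G x i).bind ?_
    rintro _ _ ⟨rfl, rfl⟩
    refine (ensures_boosted G x hS _ _ t i).bind fun b q hq => ?_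
    rw [List.map_cons, List.sum_cons]
    change (q : ℝ) ≤ (⌈2 * Real.logb 2 G.nhat⌉₊ : ℝ) * (c * √(G.deg i)) at hq
    -- An early stop at `s` only drops nonnegative terms.
    split_ifs with his
    · refine Prog.ensures_ret ?_
      have : 0 ≤ (order.map fun i =>
          1 + (⌈2 * Real.logb 2 G.nhat⌉₊ : ℝ) * (c * √(G.deg i))).sum := by
        refine List.sum_nonneg fun a ha => ?_
        obtain ⟨j, -, rfl⟩ := List.mem_map.1 ha
        positivity
      push_cast
      linarith
    · refine (ih _).mono fun _ q' hq' => ?_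
      push_cast
      linarith

/-- In each step, all non-sinks among the out-neighbours are in `D` or earlier in the list. -/
def Evaluable : Set (Fin n) → List (Fin n) → Prop
  | _, [] => True
  | D, i :: order => (∀ j ∈ G.adj i, 0 < G.deg j → j ∈ D) ∧ Evaluable (insert i D) order

theorem evaluable_concat (D : Set (Fin n)) (order : List (Fin n)) (i : Fin n) :
    Evaluable G D (order ++ [i]) ↔
      Evaluable G D order ∧ ∀ j ∈ G.adj i, 0 < G.deg j → j ∈ D ∨ j ∈ order := by
  induction order generalizing D with
  | nil => simp [Evaluable]
  | cons a order ih =>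
    simp only [List.cons_append, Evaluable, ih, Set.mem_insert_iff, List.mem_cons, and_assoc]
    refine and_congr_right fun _ => and_congr_right fun _ => forall₃_congr fun j _ _ => ?_
    tauto

theorem Closed.evaluable {order : List (Fin n)} (h : Closed G order) :
    Evaluable G ∅ order.reverse := by
  induction order with
  | nil => trivial
  | cons i order ih =>
    rw [List.reverse_cons, evaluable_concat]
    exact ⟨ih h.2, fun j hj hd => Or.inr (List.mem_reverse.2 (h.1 j hj hd))⟩

include hS in
-- `D` is the set of vertices whose table entries are already right. At each non-sink the correct
-- entries of its children make the table value equal to the true one, so along the ideal run only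
-- the boosted gates can err.
theorem exists_evalLoop (s : Fin n) (order : List (Fin n)) (t : Fin n → Bool) (D : Set (Fin n))
    (hev : Evaluable G D order) (ht : ∀ v ∈ D, 0 < G.deg v → t v = G.value x v) :
    ∃ t', (evalLoop S G.deg s order t).errProb (G.oracle x) {t'} ≤
        order.length * (1 / 2) ^ ⌈2 * Real.logb 2 G.nhat⌉₊ ∧
      (s ∈ order → 0 < G.deg s → t' s = G.value x s) := by
  induction order generalizing t D with
  | nil => exact ⟨t, (Prog.errProb_ret (Set.mem_singleton t)).trans_le zero_le, by simp⟩
  | cons i order ih =>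
    have hval : 0 < G.deg i → tableGate G x t i = G.value x i := by
      intro hd
      rw [tableGate, readGate, if_neg hd.ne', G.value_eq, if_neg hd.ne']
      congr 1
      refine List.map_congr_left fun j hj => ?_
      congr 1
      rw [tableValue]
      split_ifs with hdj
      · rw [G.value_eq, if_pos hdj]
      · exact ht j (hev.1 j hj (Nat.pos_of_ne_zero hdj)) (Nat.pos_of_ne_zero hdj)
    have hgate : (getGate i).errProb (G.oracle x) {readGate G i} = 0 :=
      Prog.errProb_eq_zero ((ensures_getGate G x i).mono fun _ _ h => h.1)
    have hstep : ∀ t' : Fin n → Bool, ∀ δ : ℝ≥0∞,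
        ((if i = s then .ret (Function.update t i (tableGate G x t i)) else
          evalLoop S G.deg s order (Function.update t i (tableGate G x t i)) :
            CProg n (Fin n → Bool))).errProb (G.oracle x) {t'} ≤ δ →
        (evalLoop S G.deg s (i :: order) t).errProb (G.oracle x) {t'} ≤
          (1 / 2) ^ ⌈2 * Real.logb 2 G.nhat⌉₊ + δ := by
      intro t' δ h
      rw [evalLoop]
      refine (Prog.errProb_bind_singleton (readGate G i)).trans ?_
      rw [hgate, zero_add]
      exact (Prog.errProb_bind_singleton (tableGate G x t i)).trans
        (add_le_add (errProb_boosted_le G x hS _ t i) h)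
    by_cases his : i = s
    · subst his
      refine ⟨Function.update t i (tableGate G x t i), (hstep _ 0 ?_).trans ?_,
        fun _ hd => by rw [Function.update_self, hval hd]⟩
      · rw [if_pos rfl]
        exact (Prog.errProb_ret (Set.mem_singleton _)).le
      · rw [add_zero]
        refine le_mul_of_one_le_left' ?_
        exact_mod_cast Nat.succ_pos _
    · obtain ⟨t', hp, hs⟩ := ih (Function.update t i (tableGate G x t i)) (insert i D) hev.2 (by
        intro v hv hd
        rcases eq_or_ne v i with rfl | hne
        · rw [Function.update_self, hval hd]
        · rw [Function.update_of_ne hne]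
          exact ht v (hv.resolve_left hne) hd)
      refine ⟨t', (hstep t' (order.length * (1 / 2) ^ ⌈2 * Real.logb 2 G.nhat⌉₊)
        (by rw [if_neg his]; exact hp)).trans (le_of_eq ?_), fun hmem hd => ?_⟩
      · push_cast [List.length_cons]
        ring
      · exact hs ((List.mem_cons.1 hmem).resolve_left (Ne.symm his)) hd

end Evaluation

/-! # The theorem -/

section Final

variable {n : ℕ} (G : Circuit n) (x : ℕ → Bool)

theorem closed_of_sorted {order : List (Fin n)} (hlt : ∀ i, ∀ j ∈ G.adj i, i < j)
    (hs : order.Pairwise (· < ·))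
    (hmem : ∀ i ∈ order, ∀ j ∈ G.adj i, 0 < G.deg j → j ∈ order) : Closed G order := by
  induction order with
  | nil => trivial
  | cons a order ih =>
    obtain ⟨ha, hs⟩ := List.pairwise_cons.1 hs
    refine ⟨fun j hj hd => ?_, ih hs fun i hi j hj hd => ?_⟩
    · exact (List.mem_cons.1 (hmem a List.mem_cons_self j hj hd)).resolve_left (hlt a j hj).ne'
    · exact (List.mem_cons.1 (hmem i (List.mem_cons_of_mem _ hi) j hj hd)).resolve_left
        ((ha i hi).trans (hlt i j hj)).ne'

theorem mem_take_finRange {k : ℕ} {v : Fin n} : v ∈ (List.finRange n).take k ↔ v.val < k := by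
  rw [List.mem_take_iff_getElem]
  constructor
  · rintro ⟨i, hi, rfl⟩
    simp only [List.getElem_finRange, Fin.val_cast]
    omega
  · intro h
    exact ⟨v.val, by simp [h], by simp⟩

theorem nhat_le : G.nhat ≤ n := (Finset.card_filter_le _ _).trans (Finset.card_fin n).le

theorem sum_nonsinks_deg : ∑ v, (if 0 < G.deg v then G.deg v else 0) = G.m :=
  Finset.sum_congr rfl fun v _ => by split_ifs <;> omega

theorem nhat_le_m : G.nhat ≤ G.m := by
  rw [nhat, numNonsinks, Finset.card_filter, m]
  refine Finset.sum_le_sum fun v _ => ?_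
  split_ifs <;> omega

/-- The non-sinks lie among the first `n̂` vertices and are equally many, so the two sets coincide.
-/
theorem deg_pos_of_isOrdered (h : G.IsOrdered) {v : Fin n} (hv : v.val < G.nhat) :
    0 < G.deg v := by
  have hsub : (Finset.univ.filter fun i => 0 < G.deg i) ⊆
      Finset.univ.filter fun i : Fin n => i.val < G.nhat := by
    intro i
    simp only [Finset.mem_filter, Finset.mem_univ, true_and]
    intro hi
    by_contra hn
    exact hi.ne' (h.2 i (not_lt.1 hn))
  have heq := Finset.eq_of_subset_of_card_le hsub (by
    rw [Fin.card_filter_val_lt, min_eq_right (nhat_le G)]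
    exact le_rfl)
  have : v ∈ Finset.univ.filter fun i : Fin n => i.val < G.nhat := by simpa using hv
  rw [← heq] at this
  simpa using this

/-- The first stage of the algorithm: the order of the non-sinks. -/
noncomputable def orderStage (S : Subroutines) (ordered : Bool) (starts : List (Fin n)) :
    CProg n (List (Fin n)) :=
  if ordered then .ret ((List.finRange n).take (numNonsinks G.deg)) else topSort S G.deg starts

variable {S : Subroutines} {c : ℝ} {ordered : Bool} {starts : List (Fin n)}
  (hord : ordered = true → G.IsOrdered)

include hord in
theorem exists_orderStage {ε : ℝ≥0∞}
    (hS : ∀ (visited : Fin n → Bool) (i : Fin n) (start : ℕ), ∃ z,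
      G.IsFirstFresh visited i start z ∧
        (S.firstOne G.deg visited i start).errProb (G.oracle x) {z} ≤ ε)
    (hreach : ordered = false → ∃ u ∈ starts, G.Reachable u G.root) :
    ∃ order : List (Fin n),
      (orderStage G S ordered starts).errProb (G.oracle x) {order} ≤ (2 * G.nhat : ℕ) * ε ∧
      order.length ≤ G.nhat ∧ Closed G order ∧ (0 < G.deg G.root → G.root ∈ order) := by
  cases ordered with
  | false => exact exists_topSort G x hS starts G.root (hreach rfl)
  | true =>
    obtain ⟨hlt, hsink⟩ := hord rfl
    have hmem : ∀ v : Fin n, 0 < G.deg v → v ∈ (List.finRange n).take (numNonsinks G.deg) := by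
      intro v hv
      rw [mem_take_finRange]
      by_contra hn
      exact hv.ne' (hsink v (not_lt.1 hn))
    refine ⟨_, (Prog.errProb_ret (Set.mem_singleton _)).trans_le zero_le, ?_,
      closed_of_sorted G hlt ?_ fun i _ j _ hd => hmem j hd, hmem _⟩
    · rw [List.length_take]
      exact min_le_left _ _
    · exact (List.pairwise_lt_finRange n).sublist (List.take_sublist _ _)

include hord in
theorem ensures_orderStage (hS : S.FirstOneSpec c) (hS' : S.FirstOneSound) (hc : 0 ≤ c)
    (h2 : 2 ≤ G.nhat) {l : ℝ} (hl : 0 < l) {e : Fin n → ℝ} (he : ∀ v, 0 ≤ e v) :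
    (orderStage G S ordered starts).Ensures (G.oracle x) fun order q =>
      q + (order.map e).sum ≤
        ∑ v, if 0 < G.deg v then charge G e (c * Real.log G.nhat) l v else 0 := by
  cases ordered with
  | false => exact ensures_topSort G x e hS hS' hc hl h2 he starts
  | true =>
    refine Prog.ensures_ret ?_
    have hK : 0 ≤ c * Real.log G.nhat := mul_nonneg hc (Real.log_natCast_nonneg _)
    rw [Nat.cast_zero, zero_add,
      ← List.sum_toFinset e ((List.nodup_finRange n).sublist (List.take_sublist _ _)),
      ← Finset.sum_filter]
    refine (Finset.sum_le_sum (g := charge G e (c * Real.log G.nhat) l) fun v _ => ?_).trans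
      (Finset.sum_le_sum_of_subset_of_nonneg (fun v hv => ?_) fun v _ _ => ?_)
    · have : 0 ≤ c * Real.log G.nhat / 2 * (2 * l + G.deg v / l) + 1 := by positivity
      unfold charge
      linarith
    · rw [List.mem_toFinset, mem_take_finRange] at hv
      simpa using deg_pos_of_isOrdered G (hord rfl) hv
    · have := he v
      unfold charge
      positivity

theorem ceil_logb_le {N : ℕ} (hN : 2 ≤ N) : (⌈2 * Real.logb 2 N⌉₊ : ℝ) ≤ 5 * Real.log N := by
  have hl2 := Real.log_two_gt_d9
  have hlog : Real.log 2 ≤ Real.log N := Real.log_le_log (by norm_num) (by exact_mod_cast hN)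
  have h0 : 0 ≤ 2 * Real.logb 2 N :=
    mul_nonneg zero_le_two (Real.logb_nonneg (by norm_num) (by exact_mod_cast (by omega : 1 ≤ N)))
  have h1 := (Nat.ceil_lt_add_one h0).le
  have h3 : Real.logb 2 N ≤ 1.5 * Real.log N := by
    rw [Real.logb, div_le_iff₀ (by linarith)]
    nlinarith
  nlinarith

theorem half_pow_ceil_logb_le {N : ℕ} (hN : 0 < N) :
    (1 / 2 : ℝ≥0∞) ^ ⌈2 * Real.logb 2 N⌉₊ ≤ ENNReal.ofReal (1 / (N : ℝ) ^ 2) := by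
  have hN' : (0 : ℝ) < N := by exact_mod_cast hN
  rw [show (1 / 2 : ℝ≥0∞) = ENNReal.ofReal (1 / 2) by
    rw [ENNReal.ofReal_div_of_pos (by norm_num)]; simp, ← ENNReal.ofReal_pow (by norm_num)]
  refine ENNReal.ofReal_le_ofReal ?_
  rw [one_div_pow]
  refine one_div_le_one_div_of_le (by positivity) ?_
  rw [← Real.log_le_log_iff (by positivity) (by positivity), Real.log_pow, Real.log_pow]
  have h := Nat.le_ceil (2 * Real.logb 2 N)
  have hl2 : 0 < Real.log 2 := Real.log_pos (by norm_num)
  have hdiv : 2 * Real.log N / Real.log 2 = 2 * Real.logb 2 N := by rw [Real.logb, mul_div_assoc]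
  exact_mod_cast (div_le_iff₀ hl2).1 (hdiv.trans_le h)

/-- The charges for `l = √(m / n̂)`. -/
theorem sum_charge_le (hc : 0 ≤ c) (h2 : 2 ≤ G.nhat) :
    (∑ v, if 0 < G.deg v then charge G (fun v => 1 + (⌈2 * Real.logb 2 G.nhat⌉₊ : ℝ) *
        (c * √(G.deg v))) (c * Real.log G.nhat) (√G.m / √G.nhat) v else 0) + 1 ≤
      (7 * c + 5) * (√((G.nhat : ℝ) * G.m) * Real.log G.nhat) := by
  have hn : (2 : ℝ) ≤ G.nhat := by exact_mod_cast h2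
  have hm : (G.nhat : ℝ) ≤ G.m := by exact_mod_cast nhat_le_m G
  have hm0 : (0 : ℝ) < G.m := by linarith
  have hsn : 0 < √(G.nhat : ℝ) := Real.sqrt_pos.2 (by linarith)
  have hsm : 0 < √(G.m : ℝ) := Real.sqrt_pos.2 hm0
  have hl : 0 < √(G.m : ℝ) / √G.nhat := div_pos hsm hsn
  have hlog : Real.log 2 ≤ Real.log G.nhat := Real.log_le_log (by norm_num) hn
  have hl2 := Real.log_two_gt_d9
  have hk := ceil_logb_le h2
  set k : ℝ := (⌈2 * Real.logb 2 G.nhat⌉₊ : ℝ) with hkdef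
  have hk0 : 0 ≤ k := by positivity
  set L := Real.log G.nhat
  set l := √(G.m : ℝ) / √G.nhat with hldef
  have hR : √((G.nhat : ℝ) * G.m) = √G.nhat * √G.m := Real.sqrt_mul (by linarith) _
  set R := √((G.nhat : ℝ) * G.m)
  have hR1 : l * G.nhat = R := by
    rw [hR, hldef]
    nth_rewrite 2 [← Real.mul_self_sqrt (show (0 : ℝ) ≤ G.nhat by linarith)]
    field_simp
  have hR2 : (G.m : ℝ) / l = R := by
    rw [hR, hldef]
    nth_rewrite 1 [← Real.mul_self_sqrt hm0.le]
    field_simp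
  have hnR : (G.nhat : ℝ) ≤ R := by
    rw [Real.le_sqrt (by linarith) (by positivity), pow_two]
    exact mul_le_mul_of_nonneg_left hm (by linarith)
  -- The evaluation cost `k * c * √d` is linearized with the same `l` as the searches, so that only
  -- the number of non-sinks and the sum of degrees matter.
  have hle : (∑ v, if 0 < G.deg v then charge G (fun v => 1 + k * (c * √(G.deg v))) (c * L) l v
      else 0) ≤ ∑ v, ((if 0 < G.deg v then (1 : ℝ) else 0) * (c * L * l + 2 + k * c * l / 2) +
        (if 0 < G.deg v then (G.deg v : ℝ) else 0) * ((c * L + k * c) / 2 / l)) := by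
    refine Finset.sum_le_sum fun v _ => ?_
    split_ifs
    · have h := mul_le_mul_of_nonneg_left (sqrt_le_half_add hl (Nat.cast_nonneg (G.deg v)))
        (mul_nonneg hk0 hc)
      have h' : k * c * ((l + (G.deg v : ℝ) / l) / 2) + c * L / 2 * (2 * l + G.deg v / l) + 2 =
          1 * (c * L * l + 2 + k * c * l / 2) + (G.deg v : ℝ) * ((c * L + k * c) / 2 / l) := by
        field_simp
        ring
      unfold charge
      linarith
    · simp
  have h1 : ∑ v, (if 0 < G.deg v then (1 : ℝ) else 0) = G.nhat := by
    simp [nhat, numNonsinks]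
  have h3 : ∑ v, (if 0 < G.deg v then (G.deg v : ℝ) else 0) = G.m := by
    rw [← sum_nonsinks_deg]
    push_cast
    rfl
  rw [Finset.sum_add_distrib, ← Finset.sum_mul, ← Finset.sum_mul, h1, h3] at hle
  -- The choice of `l` balances both parts: `n̂ * l = m / l = √(n̂ m)`.
  have heq : (G.nhat : ℝ) * (c * L * l + 2 + k * c * l / 2) +
      (G.m : ℝ) * ((c * L + k * c) / 2 / l) = (3 / 2 * c * L + k * c) * R + 2 * G.nhat := by
    have : (G.m : ℝ) * ((c * L + k * c) / 2 / l) = (c * L + k * c) / 2 * (G.m / l) := by ring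
    rw [this, hR2]
    nth_rewrite 1 [← hR1]
    rw [← hR1]
    ring
  have hR0 : 0 ≤ R := by linarith
  have hL : 1 ≤ 1.5 * L := by linarith
  -- With `k ≤ 5 * L` the main terms are `6.5 * c * R * L`. The rest, `2 * n̂ + 1 ≤ 3 * R ≤ 4.5 * R
  -- * L`, includes one query for the variable of a root that is a sink.
  have hkc : k * c * R ≤ 5 * L * c * R := by gcongr
  have hRL : 3 * R ≤ 4.5 * (R * L) := by nlinarith
  have hcRL : 0 ≤ c * (R * L) := mul_nonneg hc (mul_nonneg hR0 (by linarith))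
  nlinarith

end Final

/-- There are quantum subroutines as required by the algorithm, and with them the algorithm
evaluates all NAND-NOT and all NAND-AND-OR-NOT circuits within the stated bounds; `starts` may be
the list of all sources, or the list that consists of the root, for example. -/
theorem theorem2 :
    ∃ (S : Subroutines) (c : ℝ), S.FirstOneSpec c ∧ S.SearchSpec c ∧
      ∃ C : ℝ, ∀ (n : ℕ) (G : Circuit n) (x : ℕ → Bool) (ordered : Bool) (starts : List (Fin n)),
        (G.IsNandNot ∨ G.IsNandAndOrNot) →
        2 ≤ G.nhat →
        (ordered = true → G.IsOrdered) →
        (ordered = false → ∃ u ∈ starts, G.Reachable u G.root) →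
        (∀ ω ∈ ((S.algorithm G.deg ordered starts G.root).run (G.oracle x)).support,
          (ω.2 : ℝ) ≤ C * (√((G.nhat : ℝ) * G.m) * Real.log G.nhat) ∧
          (ω.2 : ℝ) ≤ C * (√((n : ℝ) * G.m) * Real.log n)) ∧
        ((S.algorithm G.deg ordered starts G.root).run (G.oracle x)).toOuterMeasure
            {ω | ω.1 ≠ G.value x G.root} ≤ ENNReal.ofReal (C / G.nhat) := by
  have hF : groverSubroutines.FirstOneSpec 11016 := firstOneSpec_groverSubroutines le_rfl
  have hF' : groverSubroutines.FirstOneSound := fun G x visited i start =>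
    (ensures_firstOne G x visited i start).mono fun _ _ h => h.2
  have hS : groverSubroutines.SearchSpec 11016 := searchSpec_groverSubroutines (by norm_num)
  refine ⟨groverSubroutines, 11016, hF, hS, 7 * 11016 + 5, ?_⟩
  intro n G x ordered starts _ h2 hord hreach
  have hn : (2 : ℝ) ≤ G.nhat := by exact_mod_cast h2
  have hm : (G.nhat : ℝ) ≤ G.m := by exact_mod_cast nhat_le_m G
  constructor
  · have hcost : (groverSubroutines.algorithm G.deg ordered starts G.root).Ensures (G.oracle x)
        fun _ q => (q : ℝ) ≤
          (7 * 11016 + 5) * (√((G.nhat : ℝ) * G.m) * Real.log G.nhat) := by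
      refine (ensures_orderStage G x hord hF hF' (by norm_num) h2
        (l := √G.m / √G.nhat) (div_pos (Real.sqrt_pos.2 (by linarith))
          (Real.sqrt_pos.2 (by linarith)))
        (e := fun v => 1 + (⌈2 * Real.logb 2 G.nhat⌉₊ : ℝ) * (11016 * √(G.deg v)))
        fun v => by positivity).bind ?_
      intro order q hq
      refine (ensures_evalLoop G x hS G.root order.reverse _ (by norm_num)).bind ?_
      intro t q' hq'
      rw [List.map_reverse, List.sum_reverse] at hq'
      have hsum := sum_charge_le G (c := 11016) (by norm_num) h2
      split_ifs with hd
      · refine (ensures_getVar G x hd).mono ?_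
        rintro b _ ⟨-, rfl⟩
        push_cast
        linarith
      · refine Prog.ensures_ret ?_
        push_cast
        linarith
    intro ω hω
    have h := hcost ω hω
    have hnn : (G.nhat : ℝ) ≤ n := by exact_mod_cast nhat_le G
    refine ⟨h, h.trans (mul_le_mul_of_nonneg_left (mul_le_mul
      (Real.sqrt_le_sqrt (mul_le_mul_of_nonneg_right hnn (by linarith)))
      (Real.log_le_log (by linarith) hnn) (Real.log_natCast_nonneg _) (Real.sqrt_nonneg _))
      (by norm_num))⟩
  · change (groverSubroutines.algorithm G.deg ordered starts G.root).errProb (G.oracle x)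
      {G.value x G.root} ≤ _
    obtain ⟨order, hp, hlen, hcl, hroot⟩ := exists_orderStage G x hord
      (fun visited i start => exists_isFirstFresh_errProb_le G x visited i start h2) hreach
    obtain ⟨t, hp', ht⟩ := exists_evalLoop G x hS G.root order.reverse (fun _ => false) ∅
      (hcl.evaluable G) (by simp)
    have hlast : (if G.deg G.root = 0 then getVar G.root else .ret (t G.root) :
        CProg n Bool).errProb (G.oracle x) {G.value x G.root} = 0 := by
      split_ifs with hd
      · refine Prog.errProb_eq_zero ((ensures_getVar G x hd).mono ?_)
        rintro b _ ⟨rfl, -⟩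
        rw [Set.mem_singleton_iff, G.value_eq, if_pos hd]
      · have hd' := Nat.pos_of_ne_zero hd
        exact Prog.errProb_ret (ht (List.mem_reverse.2 (hroot hd')) hd')
    have htotal : (groverSubroutines.algorithm G.deg ordered starts G.root).errProb (G.oracle x)
        {G.value x G.root} ≤ (2 * G.nhat : ℕ) * ENNReal.ofReal (1 / (G.nhat : ℝ) ^ 2) +
          (G.nhat : ℝ≥0∞) * ENNReal.ofReal (1 / (G.nhat : ℝ) ^ 2) := by
      refine (Prog.errProb_bind_singleton order).trans (add_le_add hp ?_)
      refine (Prog.errProb_bind_singleton t).trans ?_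
      rw [hlast, add_zero]
      refine hp'.trans (mul_le_mul' ?_ (half_pow_ceil_logb_le (by omega)))
      rw [List.length_reverse]
      exact_mod_cast hlen
    refine htotal.trans ?_
    rw [← ENNReal.ofReal_natCast, ← ENNReal.ofReal_natCast, ← ENNReal.ofReal_mul (by positivity),
      ← ENNReal.ofReal_mul (by positivity), ← ENNReal.ofReal_add (by positivity) (by positivity)]
    refine ENNReal.ofReal_le_ofReal ?_
    -- Sorting contributes `2 / n̂` and the gates `1 / n̂`.
    have h3 : ((2 * G.nhat : ℕ) : ℝ) * (1 / (G.nhat : ℝ) ^ 2) + G.nhat * (1 / (G.nhat : ℝ) ^ 2) =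
        3 / G.nhat := by
      push_cast
      field_simp
      ring
    rw [h3]
    exact div_le_div_of_nonneg_right (by norm_num) (by linarith)
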